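/- Consider a finite extensive-form game in which player $i$ has perfect recall, with utility $u_i:\mathcal Z\to[-U,U]$ on terminal histories. Let $\mathcal I_i$ be the set of $i$'s information sets, $\mathcal A(I)$ the actions at $I$, $\prec$ the predecessor relation on $\mathcal I_i$, and $\mathbb h(I)$ any history in $I$. Strategies $\sigma_i$ are behavioral strategies, identified with the corresponding product distributions over pure strategies $s_i$; $\sigma_{-i}$ denotes the strategies of the other players and chance. \emph{Deviations.} The deviation player carries a memory state $g$, a string that is initially empty. A behavioral deviation $\phi$ assigns to each information set $I$ and memory state $g$ an action transformation $\phi_{I,g}:\mathcal A(I)\to\mathcal A(I)$ that is the identity, external (constant), or internal (maps one action to another and fixes the rest). At $I$ with memory $g$ and recommendation $a=s_i(I)$ it plays $\phi_{I,g}(a)$ and appends to $g$ the observation $o(a;\phi_{I,g})$, which is $*$ if $\phi_{I,g}$ is external and $a$ otherwise; so $\phi$ maps pure strategies to pure strategies. The memory probability $w_\phi(I,g;\sigma_i)$ is the probability that the deviation player reaches $I$ with memory $g$: it is $1$ at the empty memory if $I$ has no predecessor, and if $I'$ is the child of $I$ after action $a'$, then $w_\phi(I',gb;\sigma_i)=w_\phi(I,g;\sigma_i)\sum_{a}\mathbf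 1[\phi_{I,g}(a)=a',\,o(a;\phi_{I,g})=b]\,\sigma_i(a\mid I)$. Let $G_i(I,\phi)$ be the set of $g$ with $w_\phi(I,g;s_i)=1$ for some pure $s_i$. For a set $\Phi$ of behavioral deviations let $$\Phi_I=\{\phi_{I,g}:\phi\in\Phi,\ g\in G_i(I,\phi)\},\qquad W_I^\Phi(f)=\{w_\phi(I,g;\cdot):\phi\in\Phi,\ g\in G_i(I,\phi),\ \phi_{I,g}=f\},$$ and $\omega(\Phi_I)=\max_{a\in\mathcal A(I)}|\{f\in\Phi_I: f(a)\neq a\}|$. The single-target deviations $\Phi_{\preceq\odot}$ are the maps $\phi_{\preceq I}$ ($\phi\in\Phi$, $I\in\mathcal I_i$) that choose actions as $\phi$ does at all $\bar I\preceq I$ and follow the recommendation elsewhere. \emph{Regret.} With $P(h;\cdot)$ the probability of reaching $h$ and $P(h,z;\cdot)$ that of playing from $h$ to $z$, let $v_I(a;\sigma)=\sum_{h\in I,\,z\in\mathcal Z}P(h;\sigma_{-i})P(ha,z;\sigma)u_i(z)$, $\rho^{\mathrm{CF}}_I(a;\sigma)=v_I(a;\sigma)-\mathbb E_{a'\sim\sigma_i(I)}v_I(a';\sigma)$,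 and $\rho^{\mathrm{CF}}_I(f;\sigma)=\mathbb E_{a\sim f(\sigma_i(I))}\rho^{\mathrm{CF}}_I(a;\sigma)$ for $f:\mathcal A(I)\to\mathcal A(I)$, where $f(\sigma_i(I))$ is the push-forward. For a pure strategy $s_i$ let $v^{\mathrm{CF}}_I(s_i;\sigma_{-i})=\sum_{h\in I,z}P(h;\sigma_{-i})P(h,z;s_i,\sigma_{-i})u_i(z)$ and $v_I(s_i;\sigma_{-i})=P(\mathbb h(I);s_i)\,v^{\mathrm{CF}}_I(s_i;\sigma_{-i})$, the latter extended to mixed strategies by expectation. The full regret of a map $\phi$ of pure strategies from $I$ is $\rho_I(\phi;\sigma)=v_I(\phi(\sigma_i);\sigma_{-i})-v_I(\phi_{\prec I}(\sigma_i);\sigma_{-i})$, where $\phi_{\prec I}$ applies $\phi$ only at strict predecessors of $I$. The full regret of a behavioral deviation $\phi$ from $I$ and memory state $g$, $\rho_{I,g}(\phi;\sigma)=\mathbb E_{s_i\sim\sigma_i}\big[w_\phi(I,g;s_i)\big(v^{\mathrm{CF}}_I(\phi(s_i);\sigma_{-i})-v^{\mathrm{CF}}_I(s_i;\sigma_{-i})\big)\big]$,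 is the expected gain of $\phi$ from $I$ on, on the event that $I$ is reached with memory $g$. \emph{EFR with exact regret matching on $\Phi$.} On each round $t=1,2,\dots$, at each $I\in\mathcal I_i$, put $y^t_f=\sum_{w\in W_I^\Phi(f)}w(\sigma_i^t)\Big(\sum_{r<t}w(\sigma_i^r)\rho^{\mathrm{CF}}_I(f;\sigma^r)\Big)^+$ for $f\in\Phi_I$ and $z^t=\sum_{f\in\Phi_I}y^t_f$ (these depend on $\sigma_i^t$ only through predecessors of $I$). If $z^t>0$, then $\sigma_i^t(I)$ is a fixed point of $p\mapsto\frac1{z^t}\sum_{f\in\Phi_I}y^t_f\,f(p)$; if $z^t=0$ it is arbitrary. The other players' strategies $\sigma_{-i}^t$ are arbitrary. \textbf{Theorem.} Suppose player $i$ follows EFR with exact regret matching on a set $\Phi$ of behavioral deviations. Let $n_{\mathrm{IN}}$ be the maximum, over $\phi\in\Phi$, information sets $I$ and $g\in G_i(I,\phi)$ with $\phi_{I,g}$ not the identity, of the number of strict predecessors $\bar I$ of $I$ at which $\phi$, with the memory state that is the corresponding initial part of $g$, uses an internal transformation that is neither the identity nor constant. Let $D=\max_{I\in\mathcal I_i,\,f\in\Phi_I}|W_I^\Phi(f)|\,\omega(\Phi_I)$.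 (Maxima over empty sets are $0$.) Then for all $T\ge0$ and $I\in\mathcal I_i$, $$\sum_{t=1}^T\rho_I(\phi;\sigma^t)\le 2^{n_{\mathrm{IN}}+1}\,U\,|\mathcal I_i|\,\sqrt{DT}\qquad\text{for all }\phi\in\Phi\cup\Phi_{\preceq\odot},$$ and the same bound holds for $\sum_{t=1}^T\rho_{I,g}(\phi;\sigma^t)$ for every memory state $g$. Consequently EFR is observably sequentially hindsight rational for $\Phi\cup\Phi_{\preceq\odot}$: $\limsup_{T\to\infty}\frac1T\sum_{t=1}^T\rho_I(\phi;\sigma^t)\le0$ for all $\phi\in\Phi\cup\Phi_{\preceq\odot}$ and $I\in\mathcal I_i$. -/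

import Mathlib

/-- A finite extensive-form game with players `ι`. A history is the sequence of actions played so
far, written as a list with the LATEST action first, so that `a :: h` is the history reached from
`h` by playing `a`, and the empty list is the empty history. -/
structure EFG (ι Act Info : Type*) [Fintype Act] where
  /-- The finite set of histories, closed under passing to the predecessor. -/
  hist : Finset (List Act)
  nil_mem : [] ∈ hist
  tail_mem : ∀ a h, a :: h ∈ hist → h ∈ hist
  /-- The player function on non-terminal histories; `none` is the chance player. -/
  turn : List Act → Option ι
  /-- The label of the information set containing a decision history. The information sets of
  player `j` are the classes of equal label among the histories where `j` acts. -/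
  info : List Act → Info
  /-- Histories in one information set offer the same actions. -/
  info_actions : ∀ (j : ι) (h h' : List Act),
    (∃ a, a :: h ∈ hist) → (∃ a, a :: h' ∈ hist) → turn h = some j → turn h' = some j →
    info h = info h' → ∀ a, a :: h ∈ hist ↔ a :: h' ∈ hist
  /-- The fixed strategy of the chance player. -/
  chance : List Act → Act → ℝ
  chance_nonneg : ∀ h a, a :: h ∈ hist → turn h = none → 0 ≤ chance h a
  chance_sum : ∀ h, (∃ a, a :: h ∈ hist) → turn h = none →
    letI := Classical.decPred fun a => a :: h ∈ hist
    ∑ a ∈ Finset.univ.filter (fun a => a :: h ∈ hist), chance h a = 1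
  /-- `utility j z` is the utility of player `j` at the terminal history `z`. -/
  utility : ι → List Act → ℝ

noncomputable section EFGDefs

open Classical

/-- The push-forward of the weights `p` on a finite type under `f`. -/
def pushWeights {X : Type*} [Fintype X] (f : X → X) (p : X → ℝ) (y : X) : ℝ :=
  ∑ x ∈ Finset.univ.filter (fun x => f x = y), p x

/-- External transformations: the constant ones. -/
def IsExternal {X : Type*} (f : X → X) : Prop := ∃ y, ∀ x, f x = y

/-- Internal transformations: `x` is mapped to `y`, everything else is kept. -/
def IsInternal {X : Type*} (f : X → X) : Prop := ∃ x y, f = Function.update id x y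

namespace EFG

variable {ι Act Info : Type*} [Fintype Act] (G : EFG ι Act Info)

/-! ### Histories, information sets, perfect recall -/

/-- The terminal histories. -/
def terminals : Finset (List Act) := G.hist.filter fun z => ∀ a, a :: z ∉ G.hist

/-- The non-terminal histories where player `j` acts. -/
def decisions (j : ι) : Finset (List Act) :=
  G.hist.filter fun h => G.turn h = some j ∧ ∃ a, a :: h ∈ G.hist

/-- The (labels of the) information sets of player `j`. -/
def infosets (j : ι) : Finset Info := (G.decisions j).image G.info

/-- The type of information sets of player `j`. -/
abbrev InfoSet (j : ι) : Type _ := {I : Info // I ∈ G.infosets j}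

variable {G} {j : ι}

/-- The histories in an information set. -/
def InfoSet.members (I : G.InfoSet j) : Finset (List Act) :=
  (G.decisions j).filter fun h => G.info h = I.1

/-- The actions available in an information set. -/
def InfoSet.actions (I : G.InfoSet j) : Finset Act :=
  Finset.univ.filter fun a => ∃ h ∈ I.members, a :: h ∈ G.hist

/-- The type of actions available in an information set. -/
abbrev InfoSet.Action (I : G.InfoSet j) : Type _ := {a : Act // a ∈ I.actions}

theorem InfoSet.members_nonempty (I : G.InfoSet j) : ∃ h, h ∈ I.members := by
  obtain ⟨h, hh, hI⟩ := Finset.mem_image.1 I.2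
  exact ⟨h, Finset.mem_filter.2 ⟨hh, hI⟩⟩

/-- An arbitrary history of an information set. -/
def InfoSet.rep (I : G.InfoSet j) : List Act := I.members_nonempty.choose

theorem mem_decisions {h : List Act} {a : Act} (hh : G.turn h = some j ∧ a :: h ∈ G.hist) :
    h ∈ G.decisions j :=
  Finset.mem_filter.2 ⟨G.tail_mem a h hh.2, hh.1, a, hh.2⟩

/-- The information set in which player `j` acts at `h`. -/
def infoAt {h : List Act} {a : Act} (hh : G.turn h = some j ∧ a :: h ∈ G.hist) : G.InfoSet j :=
  ⟨G.info h, Finset.mem_image_of_mem _ (mem_decisions hh)⟩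

/-- The action `a`, as an action of the information set containing `h`. -/
def actionAt {h : List Act} {a : Act} (hh : G.turn h = some j ∧ a :: h ∈ G.hist) :
    (infoAt hh).Action :=
  ⟨a, Finset.mem_filter.2
    ⟨Finset.mem_univ _, h, Finset.mem_filter.2 ⟨mem_decisions hh, rfl⟩, hh.2⟩⟩

variable (G j) in
/-- The own experience of player `j` along a history: the information sets of `j` that were
passed, with the actions that `j` took there, latest first. -/
def experience : List Act → List ((I : G.InfoSet j) × I.Action)
  | [] => []
  | a :: h =>
    if hh : G.turn h = some j ∧ a :: h ∈ G.hist then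
      ⟨infoAt hh, actionAt hh⟩ :: experience h
    else experience h

variable (G j) in
/-- Perfect recall of player `j`: all histories in one information set of `j` carry the same
sequence of own information sets and own actions. -/
def PerfectRecall : Prop :=
  ∀ (I : G.InfoSet j) (h h' : List Act), h ∈ I.members → h' ∈ I.members →
    G.experience j h = G.experience j h'

/-- The line of own play leading to `I`: predecessors of `I`, latest first, each with the action
that leads towards `I`. -/
def InfoSet.path (I : G.InfoSet j) : List ((J : G.InfoSet j) × J.Action) :=
  G.experience j I.rep

/-- `J.Before I`: `J` is a (strict) predecessor of `I`. -/
def InfoSet.Before (J I : G.InfoSet j) : Prop := ∃ x ∈ I.path, x.1 = J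

/-- `J.BeforeEq I`: `J` is a predecessor of `I` or `I` itself. -/
def InfoSet.BeforeEq (J I : G.InfoSet j) : Prop := J.Before I ∨ J = I

/-! ### Strategies and reach probabilities -/

variable (G) in
/-- The behavioral strategies of player `j`. -/
abbrev Strategy (j : ι) : Type _ := (I : G.InfoSet j) → stdSimplex ℝ I.Action

variable (G) in
/-- The behavioral strategy profiles. -/
abbrev Profile : Type _ := (j : ι) → G.Strategy j

variable (G) in
/-- The pure strategies of player `j`. -/
abbrev Pure (j : ι) : Type _ := (I : G.InfoSet j) → I.Action

/-- A pure strategy as a behavioral strategy. -/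
def Pure.toStrategy (s : G.Pure j) : G.Strategy j := fun I =>
  ⟨Pi.single (s I) 1, single_mem_stdSimplex ℝ (s I)⟩

/-- The mixed strategy given by a behavioral strategy: the probability of each pure strategy. -/
def Strategy.toMixed (p : G.Strategy j) (s : G.Pure j) : ℝ := ∏ I, (p I).1 (s I)

/-- The probability with which a behavioral strategy of `j` plays `a` at the history `h`. -/
def Strategy.playProb (p : G.Strategy j) (h : List Act) (a : Act) : ℝ :=
  if hh : G.turn h = some j ∧ a :: h ∈ G.hist then (p (infoAt hh)).1 (actionAt hh) else 0

/-- The probability under a profile that `a` follows `h`. -/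
def moveProb (σ : G.Profile) (h : List Act) (a : Act) : ℝ :=
  match G.turn h with
  | none => G.chance h a
  | some k => (σ k).playProb h a

/-- The joint probability of the actions of player `j` along a history. -/
def reachOwn (p : G.Strategy j) : List Act → ℝ
  | [] => 1
  | a :: h => reachOwn p h * if G.turn h = some j then p.playProb h a else 1

/-- The joint probability of the actions of all the players but `j`, and chance, along a
history. -/
def reachOthers (j : ι) (σ : G.Profile) : List Act → ℝ
  | [] => 1
  | a :: h => reachOthers j σ h * if G.turn h = some j then 1 else moveProb σ h a

/-- The probability of playing from `h` to `z`: it is `1` if `z = h` and `0` if `h` is not a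
predecessor of `z`. -/
def reachFrom (σ : G.Profile) (h : List Act) : List Act → ℝ
  | [] => if [] = h then 1 else 0
  | a :: z => if a :: z = h then 1 else reachFrom σ h z * moveProb σ z a

/-! ### Counterfactual values and full regret -/

/-- The counterfactual value of the action `a` in the information set `I`. -/
def cfValueAction (σ : G.Profile) (I : G.InfoSet j) (a : I.Action) : ℝ :=
  ∑ h ∈ I.members, ∑ z ∈ G.terminals,
    reachOthers j σ h * (reachFrom σ (a.1 :: h) z * G.utility j z)

/-- The immediate counterfactual regret of an action. -/
def cfRegretAction (σ : G.Profile) (I : G.InfoSet j) (a : I.Action) : ℝ :=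
  cfValueAction σ I a - ∑ a' : I.Action, (σ j I).1 a' * cfValueAction σ I a'

/-- The immediate counterfactual regret of an action transformation. -/
def cfRegret (σ : G.Profile) (I : G.InfoSet j) (f : I.Action → I.Action) : ℝ :=
  ∑ a : I.Action, pushWeights f (σ j I).1 a * cfRegretAction σ I a

/-- The counterfactual value from `I` of the strategy `p` of player `j` against the strategies of
the others in `σ`. -/
def cfValue (I : G.InfoSet j) (p : G.Strategy j) (σ : G.Profile) : ℝ :=
  ∑ h ∈ I.members, ∑ z ∈ G.terminals,
    reachOthers j σ h * (reachFrom (Function.update σ j p) h z * G.utility j z)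

/-- The reach-probability-weighted counterfactual value from `I` of a pure strategy. -/
def purValue (I : G.InfoSet j) (s : G.Pure j) (σ : G.Profile) : ℝ :=
  reachOwn s.toStrategy I.rep * cfValue I s.toStrategy σ

/-- The reach-probability-weighted counterfactual value from `I` of a mixed strategy. (Under
perfect recall own reach probabilities of mixed strategies are the expectations of those of the
pure strategies, so the weighted value, which only involves the own probabilities of reaching
terminal histories, is the expectation of the weighted value of the pure strategies.) -/
def mixedValue (I : G.InfoSet j) (μ : G.Pure j → ℝ) (σ : G.Profile) : ℝ :=
  ∑ s : G.Pure j, μ s * purValue I s σ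

/-- The deviation that applies `ψ` strictly before `I` only. -/
def devBefore (ψ : G.Pure j → G.Pure j) (I : G.InfoSet j) : G.Pure j → G.Pure j :=
  fun s J => if J.Before I then ψ s J else s J

/-- The deviation that applies `ψ` at `I` and before `I` only. -/
def devUpTo (ψ : G.Pure j → G.Pure j) (I : G.InfoSet j) : G.Pure j → G.Pure j :=
  fun s J => if J.BeforeEq I then ψ s J else s J

/-- The full regret of a swap deviation `ψ` of player `j` from the information set `I`. -/
def fullRegret (ψ : G.Pure j → G.Pure j) (I : G.InfoSet j) (σ : G.Profile) : ℝ :=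
  mixedValue I (pushWeights ψ (σ j).toMixed) σ
    - mixedValue I (pushWeights (devBefore ψ I) (σ j).toMixed) σ

/-- The single-target deviations generated from a set of swap deviations. -/
def singleTarget (Ψ : Set (G.Pure j → G.Pure j)) : Set (G.Pure j → G.Pure j) :=
  {ψ' | ∃ ψ ∈ Ψ, ∃ I : G.InfoSet j, ψ' = devUpTo ψ I}

/-- Observable sequential hindsight rationality of player `j` for the set `Ψ` of swap deviations
along a sequence of profiles: at every information set the upper limit of the average full regret
of every deviation is at most zero. -/
def OSHindsightRational (Ψ : Set (G.Pure j → G.Pure j)) (σ : ℕ → G.Profile) : Prop :=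
  ∀ ψ ∈ Ψ, ∀ I : G.InfoSet j, ∀ ε > 0, ∀ᶠ T : ℕ in Filter.atTop,
    (1 / (T : ℝ)) * ∑ t ∈ Finset.range T, fullRegret ψ I (σ t) ≤ ε

/-! ### Behavioral deviations -/

/-- A memory state of the deviation player: one character for each earlier own information set,
latest first; `none` is the character `*`. -/
abbrev Memory (Act : Type*) : Type _ := List (Option Act)

variable (G) in
/-- A behavioral deviation assigns to each information set and memory state an identity, external
or internal action transformation. -/
abbrev BehDev (j : ι) : Type _ :=
  (I : G.InfoSet j) → Memory Act →
    {f : I.Action → I.Action // f = id ∨ IsExternal f ∨ IsInternal f}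

/-- What the deviation player observes when applying `f` to the recommendation `a`. -/
def observe {I : G.InfoSet j} (f : I.Action → I.Action) (a : I.Action) : Option Act :=
  if IsExternal f then none else some a.1

namespace BehDev

/-- The memory state after passing a line of information sets under pure recommendations. -/
def memory (φ : G.BehDev j) (s : G.Pure j) : List ((J : G.InfoSet j) × J.Action) → Memory Act
  | [] => []
  | x :: p => observe (φ x.1 (memory φ s p)).1 (s x.1) :: memory φ s p

/-- The swap deviation on pure strategies performed by a behavioral deviation. -/
def toSwap (φ : G.BehDev j) : G.Pure j → G.Pure j :=
  fun s I => (φ I (φ.memory s I.path)).1 (s I)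

/-- The memory probabilities along a line of own play. -/
def memProbAux (φ : G.BehDev j) (p : G.Strategy j) :
    List ((J : G.InfoSet j) × J.Action) → Memory Act → ℝ
  | [], [] => 1
  | x :: l, b :: g => memProbAux φ p l g *
      ∑ a : x.1.Action,
        if (φ x.1 g).1 a = x.2 ∧ observe (φ x.1 g).1 a = b then (p x.1).1 a else 0
  | _, _ => 0

/-- The memory probability: the probability that the deviation player reaches `I` with memory
state `g` under the recommendations `p`. -/
def memProb (φ : G.BehDev j) (I : G.InfoSet j) (g : Memory Act) (p : G.Strategy j) : ℝ :=
  φ.memProbAux p I.path g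

/-- The memory states that `φ` can realize in `I`. -/
def realizable (φ : G.BehDev j) (I : G.InfoSet j) : Set (Memory Act) :=
  {g | ∃ s : G.Pure j, φ.memProb I g s.toStrategy = 1}

/-- The behavioral deviation that applies `φ` at `I` and before `I` only. -/
def upTo (φ : G.BehDev j) (I : G.InfoSet j) : G.BehDev j :=
  fun J g => if J.BeforeEq I then φ J g else ⟨id, Or.inl rfl⟩

/-- The full regret of a behavioral deviation from `I` and memory state `g`: the expected gain
in counterfactual value from `I` on over following the recommendations, on the event that the
deviation player reaches `I` with memory state `g`. -/
def memFullRegret (φ : G.BehDev j) (I : G.InfoSet j) (g : Memory Act) (σ : G.Profile) : ℝ :=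
  ∑ s : G.Pure j, (σ j).toMixed s * (φ.memProb I g s.toStrategy *
    (cfValue I (φ.toSwap s).toStrategy σ - cfValue I s.toStrategy σ))

/-- The number of information sets along a line of own play at which, in the course of building
up the given memory state, `φ` uses a non-identity internal transformation. (A transformation of
a two-element action set that is constant counts as external, consistently with the fact that the
deviation player does not observe the recommendation.) -/
def internalCount (φ : G.BehDev j) :
    List ((J : G.InfoSet j) × J.Action) → Memory Act → ℕ
  | x :: l, _ :: g => internalCount φ l g +
      if IsInternal (φ x.1 g).1 ∧ ¬ IsExternal (φ x.1 g).1 ∧ (φ x.1 g).1 ≠ id then 1 else 0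
  | _, _ => 0

end BehDev

/-- The maximum number of non-identity internal transformations on one line of play before a
non-identity transformation, within a single deviation of `Φ`. -/
def nIN (Φ : Set (G.BehDev j)) : ℕ :=
  sSup {n | ∃ φ ∈ Φ, ∃ I : G.InfoSet j, ∃ g ∈ φ.realizable I,
    (φ I g).1 ≠ id ∧ n = φ.internalCount I.path g}

/-! ### Extensive-form regret minimization -/

/-- The action transformations that `Φ` uses in `I`, across realizable memory states. -/
def transformations (Φ : Set (G.BehDev j)) (I : G.InfoSet j) :
    Finset (I.Action → I.Action) :=
  Finset.univ.filter fun f => ∃ φ ∈ Φ, ∃ g ∈ φ.realizable I, (φ I g).1 = f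

/-- The set of time selection functions of an action transformation. A time selection function is
recorded as a function `w` of the strategy of player `j`; its weight on round `t` is `w` at the
strategy of round `t`. -/
def timeSelection (Φ : Set (G.BehDev j)) (I : G.InfoSet j) (f : I.Action → I.Action) :
    Set (G.Strategy j → ℝ) :=
  {w | ∃ φ ∈ Φ, ∃ g ∈ φ.realizable I, (φ I g).1 = f ∧ w = φ.memProb I g}

/-- The maximal activation of the transformations in `I`. -/
def maxActivation (Φ : Set (G.BehDev j)) (I : G.InfoSet j) : ℕ :=
  Finset.univ.sup fun a : I.Action => ((transformations Φ I).filter fun f => f a ≠ a).card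

/-- The maximum over information sets and action transformations of the number of time selection
functions times the maximal activation. -/
def bigD (Φ : Set (G.BehDev j)) : ℕ :=
  Finset.univ.sup fun I : G.InfoSet j => (transformations Φ I).sup fun f =>
    (timeSelection Φ I f).ncard * maxActivation Φ I

/-- The cumulative immediate regret of `f` in `I` with respect to the time selection function `w`
over the rounds before round `t`. -/
def cumRegret (σ : ℕ → G.Profile) (I : G.InfoSet j) (f : I.Action → I.Action)
    (w : G.Strategy j → ℝ) (t : ℕ) : ℝ :=
  ∑ r ∈ Finset.range t, w (σ r j) * cfRegret (σ r) I f

/-- The link output of `f` in `I` on round `t`. -/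
def linkOutput (Φ : Set (G.BehDev j)) (σ : ℕ → G.Profile) (I : G.InfoSet j) (t : ℕ)
    (f : I.Action → I.Action) : ℝ :=
  ∑ᶠ w ∈ timeSelection Φ I f, w (σ t j) * max (cumRegret σ I f w t) 0

/-- The sum of the link outputs in `I` on round `t`. -/
def linkSum (Φ : Set (G.BehDev j)) (σ : ℕ → G.Profile) (I : G.InfoSet j) (t : ℕ) : ℝ :=
  ∑ f ∈ transformations Φ I, linkOutput Φ σ I t f

/-- In the sequence of profiles `σ`, with rounds numbered from `0`, player `j` plays according to
EFR with exact regret matching and the deviations `Φ`: on each round and in each information set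
the immediate strategy is a fixed point of the regret matching operator, and it is arbitrary where
the sum of the link outputs is zero. The play of the others is unrestricted. -/
def FollowsEFR (Φ : Set (G.BehDev j)) (σ : ℕ → G.Profile) : Prop :=
  ∀ (t : ℕ) (I : G.InfoSet j), 0 < linkSum Φ σ I t →
    ∀ a : I.Action,
      (1 / linkSum Φ σ I t) * ∑ f ∈ transformations Φ I,
        linkOutput Φ σ I t f * pushWeights f (σ t j I).1 a = (σ t j I).1 a

end EFG

end EFGDefs

/-!
The proof has two independent halves.

**Decomposition.** Under perfect recall the line of own play to every terminal history determines,
at each of its information sets, the line leading there. Grouping the terminal histories by their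
own play, both the full regret of a deviation and the immediate counterfactual regrets become sums
over terminal histories of (probability of the others) × (utility) × (a function of the line of own
play). On a single line the gain of a deviation telescopes: the deviation player and the
recommendations are compared step by step, and the step at `J` with memory `g'` contributes the
immediate gain of `φ J g'`, weighted with the memory probability. Since the recommendation at `J`
is independent of everything before it, expectations over pure strategies factor along the line
(`sum_toMixed_contProb_sub`). Summed over terminal histories, this says that the full regret from
`I` and `g` equals the sum of `memProb J g' * cfRegret J (φ J g')` over the later `J` and the `g'`
extending `g` (`memFullRegret_eq_sum`); the full regret of the swap deviation is the sum of this
over all `g` (`fullRegret_toSwap`).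

**Regret matching.** For each `J` consider the sum of the squared positive parts of the cumulative
regrets over all pairs of a transformation and a time selection function. The fixed point property
makes the first-order term of its growth vanish (`sum_linkOutput_mul_cfRegret`). In the
second-order term a transformation only counts at the actions that it moves, so each round adds at
most `(2 * U) ^ 2 * bigD Φ` (`sum_sq_le`), and each cumulative regret is at most
`2 * U * √(bigD Φ * T)` (`cumRegret_le`).

It remains to count the terms of the decomposition. Only non-identity transformations at realizable
memory states matter, and a Kraft-type inequality bounds the number of such memory states in one
information set by `2 ^ nIN Φ`, because an observation is determined by the action played except at
internal transformations, where two are possible (`sum_realizable_pow_internalCount_le_one`).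
Truncated deviations are covered because, where they act, they agree with the original deviation.
-/

noncomputable section

open Classical

namespace EFG

variable {ι Act Info : Type*} [Fintype Act] {G : EFG ι Act Info} {j : ι}

/-! ### Lines of own play under perfect recall -/

/-- A line of own play (latest first) is coherent if the part of it before each of its information
sets is the line of own play leading to that information set. -/
def Coherent : List ((I : G.InfoSet j) × I.Action) → Prop
  | [] => True
  | x :: l => x.1.path = l ∧ Coherent l

theorem InfoSet.rep_mem (I : G.InfoSet j) : I.rep ∈ I.members := I.members_nonempty.choose_spec

theorem mem_members_iff {I : G.InfoSet j} {h : List Act} :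
    h ∈ I.members ↔ ∃ a, ∃ hh : G.turn h = some j ∧ a :: h ∈ G.hist, infoAt hh = I := by
  unfold InfoSet.members decisions
  simp only [Finset.mem_filter]
  constructor
  · rintro ⟨⟨-, ht, a, ha⟩, hI⟩
    exact ⟨a, ⟨ht, ha⟩, Subtype.ext hI⟩
  · rintro ⟨a, hh, rfl⟩
    exact ⟨⟨G.tail_mem a h hh.2, hh.1, a, hh.2⟩, rfl⟩

theorem mem_members_infoAt {h : List Act} {a : Act} (hh : G.turn h = some j ∧ a :: h ∈ G.hist) :
    h ∈ (infoAt hh).members :=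
  mem_members_iff.2 ⟨a, hh, rfl⟩

theorem mem_members_iff_infoAt {h : List Act} {a : Act}
    (hh : G.turn h = some j ∧ a :: h ∈ G.hist) (I : G.InfoSet j) :
    h ∈ I.members ↔ infoAt hh = I := by
  constructor
  · intro h'
    obtain ⟨b, hb, rfl⟩ := mem_members_iff.1 h'
    rfl
  · rintro rfl
    exact mem_members_infoAt hh

theorem experience_cons_own {h : List Act} {a : Act}
    (hh : G.turn h = some j ∧ a :: h ∈ G.hist) :
    G.experience j (a :: h) = ⟨infoAt hh, actionAt hh⟩ :: G.experience j h := by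
  rw [experience, dif_pos hh]

theorem experience_cons_other {h : List Act} {a : Act} (hh : G.turn h ≠ some j) :
    G.experience j (a :: h) = G.experience j h := by
  rw [experience, dif_neg fun h' => hh h'.1]

theorem coherent_experience (hr : G.PerfectRecall j) (h : List Act) :
    Coherent (G.experience j h) := by
  induction h with
  | nil => trivial
  | cons a h ih =>
    by_cases hh : G.turn h = some j ∧ a :: h ∈ G.hist
    · rw [experience_cons_own hh]
      exact ⟨hr _ _ _ (InfoSet.rep_mem _) (mem_members_infoAt hh), ih⟩
    · rwa [experience, dif_neg hh]

theorem coherent_path (hr : G.PerfectRecall j) (I : G.InfoSet j) : Coherent I.path :=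
  coherent_experience hr _

theorem Coherent.path_suffix {l : List ((I : G.InfoSet j) × I.Action)} (hl : Coherent l)
    {x : (I : G.InfoSet j) × I.Action} (hx : x ∈ l) : x :: x.1.path <:+ l := by
  induction l with
  | nil => simp at hx
  | cons y l ih =>
    rcases List.mem_cons.1 hx with rfl | hx
    · rw [hl.1]
    · exact (ih hl.2 hx).trans (List.suffix_cons _ _)

/-- No information set is passed twice on a coherent line. -/
theorem Coherent.fst_ne {x y : (I : G.InfoSet j) × I.Action}
    {l : List ((I : G.InfoSet j) × I.Action)} (hl : Coherent (x :: l)) (hy : y ∈ l) :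
    y.1 ≠ x.1 := by
  intro hyx
  have h := (hl.2.path_suffix hy).length_le
  rw [hyx, hl.1] at h
  simp at h

theorem not_before_self (hr : G.PerfectRecall j) (I : G.InfoSet j) : ¬ I.Before I := by
  rintro ⟨x, hx, rfl⟩
  have h := ((coherent_path hr x.1).path_suffix hx).length_le
  simp at h

theorem InfoSet.Before.trans (hr : G.PerfectRecall j) {I J K : G.InfoSet j} (h : I.Before J)
    (h' : J.Before K) : I.Before K := by
  obtain ⟨x, hx, rfl⟩ := h
  obtain ⟨y, hy, rfl⟩ := h'
  have hs := (coherent_path hr K).path_suffix hy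
  exact ⟨x, hs.subset (List.mem_cons_of_mem _ hx), rfl⟩

/-! ### Own and others' contributions to reach probabilities -/

/-- The sum, over the visits of the line of own play to `I`, of the probability that `p` follows
the line from there on, the action at `I` included. Under perfect recall there is at most one
visit; counting all of them makes the recursion unconditional. -/
def contProb (p : G.Strategy j) (I : G.InfoSet j) : List ((J : G.InfoSet j) × J.Action) → ℝ
  | [] => 0
  | x :: l => ((if x.1 = I then 1 else 0) + contProb p I l) * (p x.1).1 x.2

/-- The sum, over the visits of the line of own play to `I` that are followed by the action `a`,
of the probability that `p` follows the line after that action. -/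
def contProbAction (p : G.Strategy j) (I : G.InfoSet j) (a : I.Action) :
    List ((J : G.InfoSet j) × J.Action) → ℝ
  | [] => 0
  | x :: l => (if x = ⟨I, a⟩ then 1 else 0) + contProbAction p I a l * (p x.1).1 x.2

theorem moveProb_own (σ : G.Profile) {h : List Act} {a : Act}
    (hh : G.turn h = some j ∧ a :: h ∈ G.hist) :
    moveProb σ h a = (σ j (infoAt hh)).1 (actionAt hh) := by
  unfold moveProb
  rw [hh.1]
  simp only [Strategy.playProb]
  rw [dif_pos hh]

theorem moveProb_update (σ : G.Profile) (p : G.Strategy j) {h : List Act} {a : Act}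
    (hh : G.turn h ≠ some j) : moveProb (Function.update σ j p) h a = moveProb σ h a := by
  unfold moveProb
  split
  · rfl
  · rename_i k hk
    have : k ≠ j := by rintro rfl; exact hh hk
    rw [Function.update_of_ne this]

theorem reachOthers_update (σ : G.Profile) (p : G.Strategy j) (h : List Act) :
    reachOthers j (Function.update σ j p) h = reachOthers j σ h := by
  induction h with
  | nil => rfl
  | cons a h ih =>
    simp only [reachOthers, ih]
    split_ifs with hh
    · rfl
    · rw [moveProb_update σ p hh]

theorem reachFrom_eq_zero_of_length_lt (σ : G.Profile) {h z : List Act}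
    (hlt : z.length < h.length) : reachFrom σ h z = 0 := by
  induction z with
  | nil =>
    rw [reachFrom, if_neg]
    rintro rfl
    simp at hlt
  | cons a z ih =>
    rw [reachFrom, if_neg, ih (by simp at hlt; omega), zero_mul]
    rintro rfl
    simp at hlt

theorem reachFrom_cons (σ : G.Profile) (h : List Act) (a : Act) (z : List Act) :
    reachFrom σ h (a :: z) = (if a :: z = h then 1 else 0) + reachFrom σ h z * moveProb σ z a := by
  rw [reachFrom]
  split_ifs with hh
  · rw [reachFrom_eq_zero_of_length_lt σ (by simp [← hh])]
    simp
  · simp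

/-- For a fixed end point `z`, the histories of `I` on the way to `z` are counted by the line of
own play to `z`, except for `z` itself. -/
theorem sum_reachOthers_mul_reachFrom (σ : G.Profile) (p : G.Strategy j) (I : G.InfoSet j)
    {z : List Act} (hz : z ∈ G.hist) :
    ∑ h ∈ I.members, reachOthers j σ h * reachFrom (Function.update σ j p) h z =
      reachOthers j σ z *
        ((if z ∈ I.members then 1 else 0) + contProb p I (G.experience j z)) := by
  induction z with
  | nil => simp [reachFrom, experience, contProb]
  | cons a z ih =>
    have ih := ih (G.tail_mem a z hz)
    simp only [reachFrom_cons, mul_add, Finset.sum_add_distrib, ← mul_assoc]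
    rw [← Finset.sum_mul, ih]
    simp only [mul_ite, mul_one, mul_zero, Finset.sum_ite_eq]
    congr 1
    by_cases ht : G.turn z = some j
    · have hh : G.turn z = some j ∧ a :: z ∈ G.hist := ⟨ht, hz⟩
      simp only [mem_members_iff_infoAt hh]
      rw [experience_cons_own hh, contProb, moveProb_own _ hh, reachOthers, if_pos ht,
        Function.update_self]
      ring
    · have : z ∉ I.members := fun h => by
        obtain ⟨b, hb, -⟩ := mem_members_iff.1 h
        exact ht hb.1
      rw [experience_cons_other ht, moveProb_update σ p ht, if_neg this, reachOthers, if_neg ht]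
      ring

theorem sum_reachOthers_mul_reachFrom_action (σ : G.Profile) (I : G.InfoSet j) (a : I.Action)
    {z : List Act} (hz : z ∈ G.hist) :
    ∑ h ∈ I.members, reachOthers j σ h * reachFrom σ (a.1 :: h) z =
      reachOthers j σ z * contProbAction (σ j) I a (G.experience j z) := by
  induction z with
  | nil => simp [reachFrom, experience, contProbAction]
  | cons b z ih =>
    have ih := ih (G.tail_mem b z hz)
    simp only [reachFrom_cons, mul_add, Finset.sum_add_distrib, ← mul_assoc]
    rw [← Finset.sum_mul, ih]
    by_cases ht : G.turn z = some j
    · have hh : G.turn z = some j ∧ b :: z ∈ G.hist := ⟨ht, hz⟩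
      rw [experience_cons_own hh, contProbAction, moveProb_own _ hh, reachOthers, if_pos ht]
      have : (∑ h ∈ I.members, reachOthers j σ h * if b :: z = a.1 :: h then 1 else 0)
          = reachOthers j σ z * if (⟨infoAt hh, actionAt hh⟩ : (J : G.InfoSet j) × J.Action)
            = ⟨I, a⟩ then 1 else 0 := by
        have key : (⟨infoAt hh, actionAt hh⟩ : (J : G.InfoSet j) × J.Action) = ⟨I, a⟩ ↔
            b = a.1 ∧ z ∈ I.members := by
          rw [mem_members_iff_infoAt hh]
          constructor
          · rintro h
            obtain ⟨rfl, h⟩ := Sigma.mk.inj_iff.1 h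
            rw [heq_iff_eq] at h
            exact ⟨by rw [← h]; rfl, rfl⟩
          · rintro ⟨h, rfl⟩
            congr 1
            exact Subtype.ext h
        simp only [key, List.cons.injEq, ite_and]
        by_cases hb : b = a.1
        · simp [hb]
        · simp [hb]
      rw [this]
      ring
    · have : z ∉ I.members := fun h => by
        obtain ⟨b, hb, -⟩ := mem_members_iff.1 h
        exact ht hb.1
      rw [experience_cons_other ht, reachOthers, if_neg ht, Finset.sum_eq_zero]
      · ring
      · intro h hh
        rw [if_neg, mul_zero]
        intro h'
        obtain ⟨-, rfl⟩ := List.cons.inj h'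
        exact this hh

theorem not_mem_members_of_terminal {z : List Act} (hz : z ∈ G.terminals) (I : G.InfoSet j) :
    z ∉ I.members := fun h => by
  obtain ⟨a, ha, -⟩ := mem_members_iff.1 h
  exact (Finset.mem_filter.1 hz).2 a ha.2

theorem cfValue_eq_sum_terminals (I : G.InfoSet j) (p : G.Strategy j) (σ : G.Profile) :
    cfValue I p σ = ∑ z ∈ G.terminals,
      reachOthers j σ z * G.utility j z * contProb p I (G.experience j z) := by
  unfold cfValue
  rw [Finset.sum_comm]
  refine Finset.sum_congr rfl fun z hz => ?_
  have := sum_reachOthers_mul_reachFrom σ p I (Finset.mem_filter.1 hz).1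
  rw [if_neg (not_mem_members_of_terminal hz I), zero_add] at this
  simp only [← mul_assoc]
  rw [← Finset.sum_mul, this]
  ring

theorem cfValueAction_eq_sum_terminals (σ : G.Profile) (I : G.InfoSet j) (a : I.Action) :
    cfValueAction σ I a = ∑ z ∈ G.terminals,
      reachOthers j σ z * G.utility j z * contProbAction (σ j) I a (G.experience j z) := by
  unfold cfValueAction
  rw [Finset.sum_comm]
  refine Finset.sum_congr rfl fun z hz => ?_
  have := sum_reachOthers_mul_reachFrom_action σ I a (Finset.mem_filter.1 hz).1
  simp only [← mul_assoc]
  rw [← Finset.sum_mul, this]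
  ring

/-! ### Expectations over pure strategies -/

theorem Strategy.nonneg (p : G.Strategy j) (I : G.InfoSet j) (a : I.Action) : 0 ≤ (p I).1 a :=
  (p I).2.1 a

theorem Strategy.sum_eq_one (p : G.Strategy j) (I : G.InfoSet j) : ∑ a, (p I).1 a = 1 :=
  (p I).2.2

theorem Strategy.sum_toMixed (p : G.Strategy j) : ∑ s, p.toMixed s = 1 := by
  have h := Finset.prod_univ_sum (fun I : G.InfoSet j => (Finset.univ : Finset I.Action))
    (fun I a => (p I).1 a)
  rw [Fintype.piFinset_univ] at h
  unfold Strategy.toMixed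
  rw [← h]
  exact Finset.prod_eq_one fun I _ => p.sum_eq_one I

theorem Strategy.toMixed_update_mul (p : G.Strategy j) (I : G.InfoSet j) (s : G.Pure j)
    (a : I.Action) :
    p.toMixed (Function.update s I a) * (p I).1 (s I) = p.toMixed s * (p I).1 a := by
  unfold Strategy.toMixed
  rw [← Finset.mul_prod_erase _ _ (Finset.mem_univ I),
    ← Finset.mul_prod_erase _ (fun J => (p J).1 (s J)) (Finset.mem_univ I), Function.update_self]
  rw [Finset.prod_congr rfl fun J hJ => by
    rw [Function.update_of_ne (Finset.ne_of_mem_erase hJ)]]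
  ring

/-- Resampling the action at one information set does not change expectations. -/
theorem Strategy.sum_toMixed_resample (p : G.Strategy j) (I : G.InfoSet j) (F : G.Pure j → ℝ) :
    ∑ s, p.toMixed s * ∑ a, (p I).1 a * F (Function.update s I a) = ∑ s, p.toMixed s * F s := by
  -- Exchanging the action at `I` with a fresh sample preserves the joint distribution.
  let e : G.Pure j × I.Action ≃ G.Pure j × I.Action :=
    { toFun := fun x => (Function.update x.1 I x.2, x.1 I)
      invFun := fun x => (Function.update x.1 I x.2, x.1 I)
      left_inv := fun x => by simp
      right_inv := fun x => by simp }
  calc ∑ s, p.toMixed s * ∑ a, (p I).1 a * F (Function.update s I a)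
      = ∑ x : G.Pure j × I.Action,
          p.toMixed x.1 * (p I).1 x.2 * F (Function.update x.1 I x.2) := by
        rw [Fintype.sum_prod_type]
        refine Finset.sum_congr rfl fun s _ => ?_
        rw [Finset.mul_sum]
        exact Finset.sum_congr rfl fun a _ => by ring
    _ = ∑ x : G.Pure j × I.Action, p.toMixed x.1 * (p I).1 x.2 * F x.1 := by
        refine Fintype.sum_equiv e _ _ fun x => ?_
        simp only [e, Equiv.coe_fn_mk]
        rw [p.toMixed_update_mul]
    _ = ∑ s, p.toMixed s * F s := by
        rw [Fintype.sum_prod_type]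
        refine Finset.sum_congr rfl fun s _ => ?_
        dsimp only
        rw [← Finset.sum_mul, ← Finset.mul_sum, p.sum_eq_one, mul_one]

/-- The action at `I` is independent of every quantity that ignores it. -/
theorem Strategy.sum_toMixed_mul_indep (p : G.Strategy j) (I : G.InfoSet j) (F : G.Pure j → ℝ)
    (hF : ∀ s a, F (Function.update s I a) = F s) (k : I.Action → ℝ) :
    ∑ s, p.toMixed s * (F s * k (s I)) = (∑ s, p.toMixed s * F s) * ∑ a, (p I).1 a * k a := by
  rw [← p.sum_toMixed_resample I, Finset.sum_mul]
  refine Finset.sum_congr rfl fun s _ => ?_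
  rw [mul_assoc, Finset.mul_sum (a := F s)]
  congr 1
  exact Finset.sum_congr rfl fun a _ => by rw [hF, Function.update_self]; ring

theorem Pure.toStrategy_apply (s : G.Pure j) (I : G.InfoSet j) (a : I.Action) :
    (s.toStrategy I).1 a = if s I = a then 1 else 0 := by
  simp [Pure.toStrategy, Pi.single_apply, eq_comm]

/-! ### Memory probabilities -/

theorem sum_pure_observe (φ : G.BehDev j) (s : G.Pure j) (x : (J : G.InfoSet j) × J.Action)
    (b : Option Act) (g : Memory Act) :
    (∑ a : x.1.Action, if (φ x.1 g).1 a = x.2 ∧ observe (φ x.1 g).1 a = b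
      then (s.toStrategy x.1).1 a else 0) =
    if (φ x.1 g).1 (s x.1) = x.2 ∧ observe (φ x.1 g).1 (s x.1) = b then 1 else 0 := by
  rw [Fintype.sum_eq_single (s x.1)]
  · simp [Pure.toStrategy_apply]
  · intro a ha
    simp [Pure.toStrategy_apply, ha.symm]

namespace BehDev

theorem memProbAux_pure_cons (φ : G.BehDev j) (s : G.Pure j)
    (x : (J : G.InfoSet j) × J.Action) (l : List ((J : G.InfoSet j) × J.Action))
    (b : Option Act) (g : Memory Act) :
    φ.memProbAux s.toStrategy (x :: l) (b :: g) = φ.memProbAux s.toStrategy l g *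
      if (φ x.1 g).1 (s x.1) = x.2 ∧ observe (φ x.1 g).1 (s x.1) = b then 1 else 0 := by
  rw [memProbAux, sum_pure_observe]

theorem memProbAux_eq_zero_of_length_ne (φ : G.BehDev j) (p : G.Strategy j)
    (l : List ((J : G.InfoSet j) × J.Action)) (g : Memory Act) (h : g.length ≠ l.length) :
    φ.memProbAux p l g = 0 := by
  induction l generalizing g with
  | nil =>
    cases g with
    | nil => simp at h
    | cons b g => rfl
  | cons x l ih =>
    cases g with
    | nil => rfl
    | cons b g => rw [memProbAux, ih g (by simpa using h), zero_mul]

theorem memProbAux_nonneg (φ : G.BehDev j) (p : G.Strategy j)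
    (l : List ((J : G.InfoSet j) × J.Action)) (g : Memory Act) : 0 ≤ φ.memProbAux p l g := by
  induction l generalizing g with
  | nil => cases g <;> simp [memProbAux]
  | cons x l ih =>
    cases g with
    | nil => simp [memProbAux]
    | cons b g =>
      rw [memProbAux]
      refine mul_nonneg (ih g) (Finset.sum_nonneg fun a _ => ?_)
      split_ifs
      · exact p.nonneg _ _
      · exact le_rfl

theorem memProbAux_le_one (φ : G.BehDev j) (p : G.Strategy j)
    (l : List ((J : G.InfoSet j) × J.Action)) (g : Memory Act) : φ.memProbAux p l g ≤ 1 := by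
  induction l generalizing g with
  | nil => cases g <;> simp [memProbAux]
  | cons x l ih =>
    cases g with
    | nil => simp [memProbAux]
    | cons b g =>
      rw [memProbAux]
      refine mul_le_one₀ (ih g) (Finset.sum_nonneg fun a _ => ?_) ?_
      · split_ifs
        · exact p.nonneg _ _
        · exact le_rfl
      · rw [← p.sum_eq_one x.1]
        refine Finset.sum_le_sum fun a _ => ?_
        split_ifs
        · exact le_rfl
        · exact p.nonneg _ _

theorem memProbAux_pure_eq_zero_or_one (φ : G.BehDev j) (s : G.Pure j)
    (l : List ((J : G.InfoSet j) × J.Action)) (g : Memory Act) :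
    φ.memProbAux s.toStrategy l g = 0 ∨ φ.memProbAux s.toStrategy l g = 1 := by
  induction l generalizing g with
  | nil => cases g <;> simp [memProbAux]
  | cons x l ih =>
    cases g with
    | nil => simp [memProbAux]
    | cons b g =>
      rw [memProbAux_pure_cons]
      split_ifs
      · simpa using ih g
      · simp

theorem memProbAux_pure_eq_zero_of_ne_memory (φ : G.BehDev j) (s : G.Pure j)
    (l : List ((J : G.InfoSet j) × J.Action)) (g : Memory Act) (hg : g ≠ φ.memory s l) :
    φ.memProbAux s.toStrategy l g = 0 := by
  induction l generalizing g with
  | nil =>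
    cases g with
    | nil => simp [memory] at hg
    | cons b g => rfl
  | cons x l ih =>
    cases g with
    | nil => rfl
    | cons b g =>
      rw [memProbAux_pure_cons]
      by_cases h : g = φ.memory s l
      · subst h
        rw [if_neg, mul_zero]
        rintro ⟨-, rfl⟩
        exact hg rfl
      · rw [ih g h, zero_mul]

theorem memProbAux_update (φ : G.BehDev j) (s : G.Pure j)
    (l : List ((J : G.InfoSet j) × J.Action)) (g : Memory Act) (I : G.InfoSet j)
    (hI : ∀ x ∈ l, x.1 ≠ I) (a : I.Action) :
    φ.memProbAux (Pure.toStrategy (Function.update s I a)) l g =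
      φ.memProbAux s.toStrategy l g := by
  induction l generalizing g with
  | nil => cases g <;> rfl
  | cons x l ih =>
    cases g with
    | nil => rfl
    | cons b g =>
      rw [memProbAux_pure_cons, memProbAux_pure_cons,
        ih g fun y hy => hI y (List.mem_cons_of_mem _ hy),
        Function.update_of_ne (hI x List.mem_cons_self)]

/-- On a coherent line, memory probabilities are multilinear: those of a behavioral strategy are
the expectations of those of the pure strategies. -/
theorem sum_toMixed_mul_memProbAux (φ : G.BehDev j) (p : G.Strategy j)
    {l : List ((J : G.InfoSet j) × J.Action)} (hl : Coherent l) (g : Memory Act) :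
    ∑ s, p.toMixed s * φ.memProbAux s.toStrategy l g = φ.memProbAux p l g := by
  induction l generalizing g with
  | nil => cases g <;> simp [memProbAux, p.sum_toMixed]
  | cons x l ih =>
    cases g with
    | nil => simp [memProbAux]
    | cons b g =>
      simp only [memProbAux_pure_cons]
      rw [p.sum_toMixed_mul_indep x.1 (fun s => φ.memProbAux s.toStrategy l g)
        (fun s a => φ.memProbAux_update s l g x.1 (fun y hy => hl.fst_ne hy) a)
        (fun r => if (φ x.1 g).1 r = x.2 ∧ observe (φ x.1 g).1 r = b then 1 else 0),
        ih hl.2, memProbAux]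
      simp

theorem memProb_eq_zero_of_not_realizable (hr : G.PerfectRecall j) (φ : G.BehDev j)
    (I : G.InfoSet j) (g : Memory Act) (hg : g ∉ φ.realizable I) (p : G.Strategy j) :
    φ.memProb I g p = 0 := by
  unfold memProb
  rw [← φ.sum_toMixed_mul_memProbAux p (coherent_path hr I) g]
  refine Finset.sum_eq_zero fun s _ => ?_
  rcases φ.memProbAux_pure_eq_zero_or_one s I.path g with h | h
  · rw [h, mul_zero]
  · exact absurd ⟨s, h⟩ hg

end BehDev

variable (Act) in
/-- The memory states of a given length. -/
def memories (n : ℕ) : Finset (Memory Act) := (List.finite_length_eq (Option Act) n).toFinset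

theorem mem_memories {n : ℕ} {g : Memory Act} : g ∈ memories Act n ↔ g.length = n := by
  simp [memories]

theorem sum_memories_zero (F : Memory Act → ℝ) : ∑ g ∈ memories Act 0, F g = F [] := by
  have : memories Act 0 = {[]} := by
    ext g
    simp [mem_memories]
  rw [this, Finset.sum_singleton]

theorem sum_memories_succ (n : ℕ) (F : Memory Act → ℝ) :
    ∑ g ∈ memories Act (n + 1), F g = ∑ g ∈ memories Act n, ∑ b : Option Act, F (b :: g) := by
  rw [← Finset.sum_product']
  refine (Finset.sum_bij (fun x _ => x.2 :: x.1) ?_ ?_ ?_ ?_).symm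
  · intro x hx
    simpa [mem_memories] using hx
  · rintro ⟨g, b⟩ _ ⟨g', b'⟩ _ h
    simp at h
    simp [h]
  · intro g hg
    cases g with
    | nil => simp [mem_memories] at hg
    | cons b g => exact ⟨(g, b), by simpa [mem_memories] using hg, rfl⟩
  · intro x _
    rfl

/-! ### The gain of a deviation along one line of own play -/

theorem contProb_eq_zero (p : G.Strategy j) (I : G.InfoSet j)
    (l : List ((J : G.InfoSet j) × J.Action)) (hI : ∀ x ∈ l, x.1 ≠ I) : contProb p I l = 0 := by
  induction l with
  | nil => rfl
  | cons x l ih =>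
    rw [contProb, if_neg (hI x List.mem_cons_self),
      ih fun y hy => hI y (List.mem_cons_of_mem _ hy)]
    simp

theorem contProb_update (s : G.Pure j) (I J : G.InfoSet j)
    (l : List ((J : G.InfoSet j) × J.Action)) (hJ : ∀ x ∈ l, x.1 ≠ J) (a : J.Action) :
    contProb (Pure.toStrategy (Function.update s J a)) I l = contProb s.toStrategy I l := by
  induction l with
  | nil => rfl
  | cons x l ih =>
    rw [contProb, contProb, ih fun y hy => hJ y (List.mem_cons_of_mem _ hy),
      Pure.toStrategy_apply, Pure.toStrategy_apply,
      Function.update_of_ne (hJ x List.mem_cons_self)]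

/-- The event that the deviation player reaches `I` with memory `g` and then follows the line of
play to `J` splits according to the memory state in `J`. -/
theorem memProb_mul_contProb (hr : G.PerfectRecall j) (φ : G.BehDev j) (s : G.Pure j)
    (I : G.InfoSet j) (g : Memory Act) (hg : g.length = I.path.length) (J : G.InfoSet j) :
    φ.memProb I g s.toStrategy *
        ((if J = I then 1 else 0) + contProb (φ.toSwap s).toStrategy I J.path) =
      ∑ g' ∈ memories Act J.path.length,
        (if I.BeforeEq J ∧ g <:+ g' then 1 else 0) * φ.memProb J g' s.toStrategy := by
  generalize hn : J.path.length = n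
  induction n using Nat.strong_induction_on generalizing J with
  | _ n ih =>
  by_cases hJI : J = I
  · subst hJI
    rw [contProb_eq_zero _ _ _ fun x hx h => not_before_self hr J ⟨x, hx, h⟩, if_pos rfl,
      Finset.sum_eq_single g]
    · rw [if_pos ⟨Or.inr rfl, List.suffix_rfl⟩]
      ring
    · intro g' hg' hne
      rw [if_neg, zero_mul]
      rintro ⟨-, hs⟩
      rw [mem_memories] at hg'
      exact hne (hs.eq_of_length (by omega)).symm
    · intro h
      exact absurd (mem_memories.2 (hg.trans hn)) h
  rw [if_neg hJI, zero_add]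
  have hco := coherent_path hr J
  have hbe : I.BeforeEq J ↔ ∃ x ∈ J.path, x.1 = I :=
    ⟨fun h => h.resolve_right fun h => hJI h.symm, Or.inl⟩
  unfold BehDev.memProb at ih ⊢
  rw [hbe]
  generalize J.path = l at *
  cases l with
  | nil => simp [contProb]
  | cons y l =>
    obtain ⟨hy, hl⟩ := hco
    subst hn
    have ih' := ih l.length (by simp) y.1 (by rw [hy])
    rw [contProb, ← mul_assoc, hy.symm, ih', List.length_cons, hy, sum_memories_succ,
      Finset.sum_mul]
    have hbe' : (∃ x ∈ y :: l, x.1 = I) ↔ I.BeforeEq y.1 := by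
      unfold InfoSet.BeforeEq InfoSet.Before
      rw [hy, List.exists_mem_cons_iff, or_comm, eq_comm (a := I)]
    refine Finset.sum_congr rfl fun g' hg' => ?_
    simp only [hbe', BehDev.memProbAux_pure_cons]
    by_cases hI : I.BeforeEq y.1
    · have hlen : g.length ≤ g'.length := by
        rw [hg, mem_memories.1 hg', ← hy]
        rcases hI with ⟨x, hx, rfl⟩ | rfl
        · have := ((coherent_path hr y.1).path_suffix hx).length_le
          simp at this
          omega
        · exact le_rfl
      have hs : ∀ b, g <:+ b :: g' ↔ g <:+ g' := fun b => by
        rw [List.suffix_cons_iff]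
        refine or_iff_right ?_
        rintro rfl
        simp at hlen
      simp only [hs]
      by_cases hgm : g' = φ.memory s l
      · have hsw : φ.toSwap s y.1 = (φ y.1 g').1 (s y.1) := by
          rw [BehDev.toSwap, hy, hgm]
        rw [Pure.toStrategy_apply, hsw]
        simp only [ite_and]
        by_cases hc : (φ y.1 g').1 (s y.1) = y.2
        · simp [hc]
        · simp [hc]
      · simp [BehDev.memProbAux_pure_eq_zero_of_ne_memory φ s l g' hgm]
    · simp [hI]

/-- Extending a line by the step `x`: the expected gain of the deviation splits into the gain of
playing the transformed instead of the recommended action at `x.1`, and the gain up to `x.1`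
followed by the recommendation at `x.1`. -/
theorem sum_toMixed_contProb_cons (hr : G.PerfectRecall j) (φ : G.BehDev j) (p : G.Strategy j)
    (I : G.InfoSet j) (g : Memory Act) (hg : g.length = I.path.length)
    (x : (J : G.InfoSet j) × J.Action) :
    ∑ s : G.Pure j, p.toMixed s * (φ.memProb I g s.toStrategy *
        (contProb (φ.toSwap s).toStrategy I (x :: x.1.path)
          - contProb s.toStrategy I (x :: x.1.path))) =
      (∑ g' ∈ memories Act x.1.path.length, (if I.BeforeEq x.1 ∧ g <:+ g' then 1 else 0) *
        (φ.memProb x.1 g' p * ∑ a, (p x.1).1 a *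
          ((if (φ x.1 g').1 a = x.2 then 1 else 0) - (if a = x.2 then 1 else 0)))) +
      (∑ s : G.Pure j, p.toMixed s * (φ.memProb I g s.toStrategy *
        (contProb (φ.toSwap s).toStrategy I x.1.path - contProb s.toStrategy I x.1.path))) *
        (p x.1).1 x.2 := by
  have hM := fun s => memProb_mul_contProb hr φ s I g hg x.1
  have hco := coherent_path hr x.1
  have hnot : ∀ y ∈ x.1.path, y.1 ≠ x.1 := fun y hy h => not_before_self hr x.1 ⟨y, hy, h⟩
  set W : G.Pure j → ℝ := fun s => φ.memProb I g s.toStrategy with hW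
  set D : G.Pure j → ℝ := fun s =>
    (if x.1 = I then 1 else 0) + contProb (φ.toSwap s).toStrategy I x.1.path with hD
  set N : G.Pure j → ℝ := fun s =>
    (if x.1 = I then 1 else 0) + contProb s.toStrategy I x.1.path with hN
  set c : Memory Act → ℝ := fun g' => if I.BeforeEq x.1 ∧ g <:+ g' then 1 else 0 with hc
  -- Following the recommendation: the action at `x.1` is independent of the earlier events.
  have hfollow : ∑ s, p.toMixed s * (W s * N s * if s x.1 = x.2 then 1 else 0) =
      (∑ s, p.toMixed s * (W s * N s)) * (p x.1).1 x.2 := by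
    rw [p.sum_toMixed_mul_indep x.1 (fun s => W s * N s) _ fun a => if a = x.2 then 1 else 0]
    · simp
    · intro s a
      simp only [hN, contProb_update s I x.1 _ hnot]
      by_cases hI : I.BeforeEq x.1
      · simp only [hW, BehDev.memProb]
        rw [BehDev.memProbAux_update]
        intro y hy hyx
        have hb : x.1.Before I := ⟨y, hy, hyx⟩
        rcases hI with hI | rfl
        · exact not_before_self hr _ (hb.trans hr hI)
        · exact not_before_self hr _ hb
      · rw [if_neg fun h => hI (Or.inr h.symm), contProb_eq_zero _ _ _ fun y hy h =>
          hI (Or.inl ⟨y, hy, h⟩)]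
        simp
  have hexp : ∑ s, p.toMixed s * (W s * D s) =
      ∑ g' ∈ memories Act x.1.path.length, c g' * φ.memProb x.1 g' p := by
    simp only [hW, hD, hM, Finset.mul_sum]
    rw [Finset.sum_comm]
    refine Finset.sum_congr rfl fun g' _ => ?_
    unfold BehDev.memProb
    rw [← φ.sum_toMixed_mul_memProbAux p hco g', Finset.mul_sum]
    exact Finset.sum_congr rfl fun s _ => by ring
  have hdev : ∑ s, p.toMixed s * (W s * D s * if φ.toSwap s x.1 = x.2 then 1 else 0) =
      ∑ g' ∈ memories Act x.1.path.length, c g' * (φ.memProb x.1 g' p *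
        ∑ a, (p x.1).1 a * if (φ x.1 g').1 a = x.2 then 1 else 0) := by
    simp only [hW, hD, hM, Finset.mul_sum, Finset.sum_mul]
    rw [Finset.sum_comm]
    refine Finset.sum_congr rfl fun g' _ => ?_
    have h := p.sum_toMixed_mul_indep x.1 (fun s => φ.memProbAux s.toStrategy x.1.path g')
      (fun s a => φ.memProbAux_update s x.1.path g' x.1 hnot a)
      (fun a => if (φ x.1 g').1 a = x.2 then 1 else 0)
    rw [φ.sum_toMixed_mul_memProbAux p hco g'] at h
    unfold BehDev.memProb
    simp only [← Finset.mul_sum]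
    rw [← h, Finset.mul_sum]
    refine Finset.sum_congr rfl fun s _ => ?_
    by_cases hgm : g' = φ.memory s x.1.path
    · rw [BehDev.toSwap, ← hgm]
      ring
    · rw [BehDev.memProbAux_pure_eq_zero_of_ne_memory φ s _ g' hgm]
      ring
  have hL : ∀ s, W s * (contProb (φ.toSwap s).toStrategy I (x :: x.1.path)
          - contProb s.toStrategy I (x :: x.1.path)) =
      (W s * D s * if φ.toSwap s x.1 = x.2 then 1 else 0)
        - (W s * N s * if s x.1 = x.2 then 1 else 0) := fun s => by
    rw [contProb, contProb, Pure.toStrategy_apply, Pure.toStrategy_apply]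
    ring
  have hR : ∀ s, W s * (contProb (φ.toSwap s).toStrategy I x.1.path
      - contProb s.toStrategy I x.1.path) = W s * D s - W s * N s := fun s => by
    simp only [hD, hN]
    ring
  change ∑ s, p.toMixed s * (W s * (contProb (φ.toSwap s).toStrategy I (x :: x.1.path)
        - contProb s.toStrategy I (x :: x.1.path))) =
    (∑ g' ∈ memories Act x.1.path.length, c g' * (φ.memProb x.1 g' p * ∑ a, (p x.1).1 a *
      ((if (φ x.1 g').1 a = x.2 then 1 else 0) - (if a = x.2 then 1 else 0)))) +
    (∑ s, p.toMixed s * (W s * (contProb (φ.toSwap s).toStrategy I x.1.path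
      - contProb s.toStrategy I x.1.path))) * (p x.1).1 x.2
  simp only [hL, hR]
  simp only [mul_sub, Finset.sum_sub_distrib]
  rw [hfollow, hdev, hexp]
  have hone : ∑ a, (p x.1).1 a * (if a = x.2 then 1 else 0) = (p x.1).1 x.2 := by simp
  have hpull : ∑ g' ∈ memories Act x.1.path.length, c g' * (φ.memProb x.1 g' p * (p x.1).1 x.2) =
      (∑ g' ∈ memories Act x.1.path.length, c g' * φ.memProb x.1 g' p) * (p x.1).1 x.2 := by
    rw [Finset.sum_mul]
    exact Finset.sum_congr rfl fun g' _ => by ring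
  rw [hone, hpull]
  ring

/-- Along one line of own play the expected gain of a deviation from `I` and `g` telescopes into
the gains of its single steps, each weighted with the probability of reaching the information set
of the step with the memory state that selects the action transformation. -/
theorem sum_toMixed_contProb_sub (hr : G.PerfectRecall j) (φ : G.BehDev j) (p : G.Strategy j)
    (I : G.InfoSet j) (g : Memory Act) (hg : g.length = I.path.length)
    {l : List ((J : G.InfoSet j) × J.Action)} (hl : Coherent l) :
    ∑ s : G.Pure j, p.toMixed s * (φ.memProb I g s.toStrategy *
        (contProb (φ.toSwap s).toStrategy I l - contProb s.toStrategy I l)) =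
      ∑ J : G.InfoSet j, ∑ g' ∈ memories Act J.path.length,
        (if I.BeforeEq J ∧ g <:+ g' then 1 else 0) * (φ.memProb J g' p * ∑ a, (p J).1 a *
          (contProbAction p J ((φ J g').1 a) l - contProbAction p J a l)) := by
  induction l with
  | nil => simp [contProb, contProbAction]
  | cons x l ih =>
    obtain ⟨hx, hl⟩ := hl
    have ih := ih hl
    subst hx
    rw [sum_toMixed_contProb_cons hr φ p I g hg x, ih, Finset.sum_mul]
    have hsplit : ∀ (J : G.InfoSet j) (a b : J.Action),
        contProbAction p J b (x :: x.1.path) - contProbAction p J a (x :: x.1.path) =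
        ((if x = ⟨J, b⟩ then 1 else 0) - (if x = ⟨J, a⟩ then 1 else 0)) +
        (contProbAction p J b x.1.path - contProbAction p J a x.1.path) * (p x.1).1 x.2 :=
      fun J a b => by simp only [contProbAction]; ring
    simp only [hsplit, mul_add, Finset.sum_add_distrib]
    congr 1
    · rw [Fintype.sum_eq_single x.1]
      · obtain ⟨J, b⟩ := x
        simp only [Sigma.mk.injEq, heq_eq_eq, true_and, eq_comm]
      · intro J hJ
        have : ∀ a : J.Action, x ≠ ⟨J, a⟩ := by
          rintro a rfl
          exact hJ rfl
        simp [this]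
    · refine Finset.sum_congr rfl fun J _ => ?_
      simp only [Finset.sum_mul, Finset.mul_sum]
      exact Finset.sum_congr rfl fun g' _ => Finset.sum_congr rfl fun a _ => by ring

/-! ### Full regret as a sum of immediate regrets -/

theorem sum_pushWeights_mul {X : Type*} [Fintype X] (f : X → X) (p k : X → ℝ) :
    ∑ y, pushWeights f p y * k y = ∑ x, p x * k (f x) := by
  unfold pushWeights
  simp only [Finset.sum_mul, Finset.sum_filter]
  rw [Finset.sum_comm]
  simp

theorem cfRegret_eq_sum (σ : G.Profile) (I : G.InfoSet j) (f : I.Action → I.Action) :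
    cfRegret σ I f =
      ∑ a, (σ j I).1 a * (cfValueAction σ I (f a) - cfValueAction σ I a) := by
  unfold cfRegret
  rw [sum_pushWeights_mul]
  simp only [cfRegretAction, mul_sub, Finset.sum_sub_distrib]
  rw [← Finset.sum_mul, (σ j).sum_eq_one, one_mul]

/-- The full regret from `I` and `g` is the sum, over the later information sets and the memory
states extending `g`, of the immediate counterfactual regrets of the selected transformations,
weighted with the memory probabilities. -/
theorem memFullRegret_eq_sum (hr : G.PerfectRecall j) (φ : G.BehDev j) (I : G.InfoSet j)
    (g : Memory Act) (hg : g.length = I.path.length) (σ : G.Profile) :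
    φ.memFullRegret I g σ = ∑ J : G.InfoSet j, ∑ g' ∈ memories Act J.path.length,
      (if I.BeforeEq J ∧ g <:+ g' then 1 else 0) *
        (φ.memProb J g' (σ j) * cfRegret σ J (φ J g').1) := by
  have h1 : φ.memFullRegret I g σ = ∑ z ∈ G.terminals, reachOthers j σ z * G.utility j z *
      ∑ s : G.Pure j, (σ j).toMixed s * (φ.memProb I g s.toStrategy *
        (contProb (φ.toSwap s).toStrategy I (G.experience j z)
          - contProb s.toStrategy I (G.experience j z))) := by
    unfold BehDev.memFullRegret
    simp only [cfValue_eq_sum_terminals, ← Finset.sum_sub_distrib, Finset.mul_sum]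
    rw [Finset.sum_comm]
    exact Finset.sum_congr rfl fun z _ => Finset.sum_congr rfl fun s _ => by ring
  rw [h1]
  simp only [cfRegret_eq_sum, cfValueAction_eq_sum_terminals, ← Finset.sum_sub_distrib,
    sum_toMixed_contProb_sub hr φ (σ j) I g hg (coherent_experience hr _), Finset.mul_sum]
  rw [Finset.sum_comm]
  refine Finset.sum_congr rfl fun J _ => ?_
  rw [Finset.sum_comm]
  refine Finset.sum_congr rfl fun g' _ => ?_
  rw [Finset.sum_comm]
  exact Finset.sum_congr rfl fun a _ => Finset.sum_congr rfl fun z _ => by ring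

theorem memFullRegret_eq_zero_of_length_ne (φ : G.BehDev j) (I : G.InfoSet j)
    (g : Memory Act) (hg : g.length ≠ I.path.length) (σ : G.Profile) :
    φ.memFullRegret I g σ = 0 := by
  unfold BehDev.memFullRegret BehDev.memProb
  simp [φ.memProbAux_eq_zero_of_length_ne _ _ _ hg]

theorem reachOwn_eq_prod (p : G.Strategy j) {h : List Act} (hh : h ∈ G.hist) :
    reachOwn p h = ((G.experience j h).map fun x => (p x.1).1 x.2).prod := by
  induction h with
  | nil => rfl
  | cons a h ih =>
    rw [reachOwn, ih (G.tail_mem a h hh)]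
    by_cases ht : G.turn h = some j
    · rw [experience_cons_own ⟨ht, hh⟩, if_pos ht, List.map_cons, List.prod_cons,
        Strategy.playProb, dif_pos ⟨ht, hh⟩, mul_comm]
    · rw [experience_cons_other ht, if_neg ht, mul_one]

theorem reachOwn_rep (p : G.Strategy j) (I : G.InfoSet j) :
    reachOwn p I.rep = (I.path.map fun x => (p x.1).1 x.2).prod :=
  reachOwn_eq_prod p (by
    have := I.rep_mem
    simp only [InfoSet.members, decisions, Finset.mem_filter] at this
    exact this.1.1)

/-- The deviation player reaches the end of a line with some memory state. -/
theorem prod_toSwap_eq_sum_memProbAux (φ : G.BehDev j) (s : G.Pure j)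
    {l : List ((J : G.InfoSet j) × J.Action)} (hl : Coherent l) :
    (l.map fun x => ((φ.toSwap s).toStrategy x.1).1 x.2).prod =
      ∑ g ∈ memories Act l.length, φ.memProbAux s.toStrategy l g := by
  induction l with
  | nil => simp [sum_memories_zero, BehDev.memProbAux]
  | cons x l ih =>
    obtain ⟨hx, hl⟩ := hl
    rw [List.map_cons, List.prod_cons, ih hl, List.length_cons, sum_memories_succ, mul_comm,
      Finset.sum_mul]
    refine Finset.sum_congr rfl fun g _ => ?_
    simp only [BehDev.memProbAux_pure_cons]
    by_cases hgm : g = φ.memory s l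
    · rw [Pure.toStrategy_apply, BehDev.toSwap, hx, ← hgm]
      simp only [ite_and]
      by_cases hc : (φ x.1 g).1 (s x.1) = x.2
      · simp [hc]
      · simp [hc]
    · simp [BehDev.memProbAux_pure_eq_zero_of_ne_memory φ s l g hgm]

theorem contProb_congr (s s' : G.Pure j) (I : G.InfoSet j)
    {l : List ((J : G.InfoSet j) × J.Action)} (hl : Coherent l)
    (h : ∀ x ∈ l, I.BeforeEq x.1 → s x.1 = s' x.1) :
    contProb s.toStrategy I l = contProb s'.toStrategy I l := by
  induction l with
  | nil => rfl
  | cons x l ih =>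
    obtain ⟨hx, hl⟩ := hl
    rw [contProb, contProb, ih hl fun y hy => h y (List.mem_cons_of_mem _ hy)]
    by_cases hI : I.BeforeEq x.1
    · rw [Pure.toStrategy_apply, Pure.toStrategy_apply, h x List.mem_cons_self hI]
    · rw [if_neg fun h => hI (Or.inr h.symm), contProb_eq_zero _ _ _ fun y hy h =>
        hI (Or.inl ⟨y, by rwa [hx], h⟩)]
      simp

/-- A deviation that acts before `I` only leaves the counterfactual value from `I` unchanged. -/
theorem cfValue_devBefore (hr : G.PerfectRecall j) (ψ : G.Pure j → G.Pure j) (I : G.InfoSet j)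
    (s : G.Pure j) (σ : G.Profile) :
    cfValue I (devBefore ψ I s).toStrategy σ = cfValue I s.toStrategy σ := by
  simp only [cfValue_eq_sum_terminals]
  refine Finset.sum_congr rfl fun z _ => ?_
  rw [contProb_congr _ _ I (coherent_experience hr z)]
  intro x _ hI
  rw [devBefore, if_neg]
  intro hb
  rcases hI with hI | rfl
  · exact not_before_self hr _ (hI.trans hr hb)
  · exact not_before_self hr _ hb

theorem fullRegret_toSwap (hr : G.PerfectRecall j) (φ : G.BehDev j) (I : G.InfoSet j)
    (σ : G.Profile) :
    fullRegret φ.toSwap I σ = ∑ g ∈ memories Act I.path.length, φ.memFullRegret I g σ := by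
  have hown : ∀ s : G.Pure j, reachOwn (devBefore φ.toSwap I s).toStrategy I.rep =
      reachOwn (φ.toSwap s).toStrategy I.rep := fun s => by
    rw [reachOwn_rep, reachOwn_rep]
    congr 1
    refine List.map_congr_left fun x hx => ?_
    have hb : x.1.Before I := ⟨x, hx, rfl⟩
    rw [Pure.toStrategy_apply, Pure.toStrategy_apply, devBefore, if_pos hb]
  unfold fullRegret mixedValue
  rw [sum_pushWeights_mul, sum_pushWeights_mul, ← Finset.sum_sub_distrib]
  unfold BehDev.memFullRegret
  rw [Finset.sum_comm]
  refine Finset.sum_congr rfl fun s _ => ?_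
  rw [purValue, purValue, hown, cfValue_devBefore hr, reachOwn_rep,
    prod_toSwap_eq_sum_memProbAux φ s (coherent_path hr I), ← Finset.mul_sum, ← Finset.sum_mul]
  unfold BehDev.memProb
  ring

/-! ### Truncated deviations -/

theorem BehDev.memory_upTo (φ : G.BehDev j) (I : G.InfoSet j)
    (s : G.Pure j) (l : List ((J : G.InfoSet j) × J.Action)) (hl : ∀ x ∈ l, x.1.BeforeEq I) :
    (φ.upTo I).memory s l = φ.memory s l := by
  induction l with
  | nil => rfl
  | cons x l ih =>
    rw [memory, memory, ih fun y hy => hl y (List.mem_cons_of_mem _ hy), upTo,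
      if_pos (hl x List.mem_cons_self)]

theorem InfoSet.BeforeEq.path_beforeEq (hr : G.PerfectRecall j) {I J : G.InfoSet j}
    (h : J.BeforeEq I) : ∀ x ∈ J.path, x.1.BeforeEq I := fun x hx => by
  have hx' : x.1.Before J := ⟨x, hx, rfl⟩
  rcases h with h | rfl
  · exact Or.inl (hx'.trans hr h)
  · exact Or.inl hx'

theorem BehDev.toSwap_upTo (hr : G.PerfectRecall j) (φ : G.BehDev j) (I : G.InfoSet j) :
    (φ.upTo I).toSwap = devUpTo φ.toSwap I := by
  funext s J
  by_cases hJ : J.BeforeEq I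
  · rw [devUpTo, if_pos hJ, toSwap, memory_upTo φ I s _ (hJ.path_beforeEq hr), upTo, if_pos hJ]
    rfl
  · rw [devUpTo, if_neg hJ, toSwap, upTo, if_neg hJ]
    rfl

theorem BehDev.memProbAux_upTo (φ : G.BehDev j) (I : G.InfoSet j) (p : G.Strategy j)
    (l : List ((J : G.InfoSet j) × J.Action)) (hl : ∀ x ∈ l, x.1.BeforeEq I) (g : Memory Act) :
    (φ.upTo I).memProbAux p l g = φ.memProbAux p l g := by
  induction l generalizing g with
  | nil => cases g <;> rfl
  | cons x l ih =>
    cases g with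
    | nil => rfl
    | cons b g =>
      rw [memProbAux, memProbAux, ih fun y hy => hl y (List.mem_cons_of_mem _ hy), upTo,
        if_pos (hl x List.mem_cons_self)]

/-! ### Bounds on counterfactual values and regrets -/

theorem InfoSet.mem_actions {I : G.InfoSet j} {h : List Act} (hI : h ∈ I.members) (a : Act) :
    a ∈ I.actions ↔ a :: h ∈ G.hist := by
  unfold InfoSet.actions
  simp only [Finset.mem_filter, Finset.mem_univ, true_and]
  refine ⟨?_, fun ha => ⟨h, hI, ha⟩⟩
  rintro ⟨h', hI', ha⟩
  simp only [InfoSet.members, decisions, Finset.mem_filter] at hI hI'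
  exact (G.info_actions j h' h hI'.1.2.2 hI.1.2.2 hI'.1.2.1 hI.1.2.1
    (hI'.2.trans hI.2.symm) a).1 ha

theorem moveProb_nonneg (σ : G.Profile) {h : List Act} {a : Act} (ha : a :: h ∈ G.hist) :
    0 ≤ moveProb σ h a := by
  cases ht : G.turn h with
  | none =>
    unfold moveProb
    rw [ht]
    exact G.chance_nonneg h a ha ht
  | some k =>
    rw [moveProb_own σ ⟨ht, ha⟩]
    exact (σ k).nonneg _ _

theorem sum_moveProb (σ : G.Profile) {h : List Act} (hh : ∃ a, a :: h ∈ G.hist) :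
    ∑ a ∈ Finset.univ.filter (fun a => a :: h ∈ G.hist), moveProb σ h a = 1 := by
  cases ht : G.turn h with
  | none =>
    unfold moveProb
    rw [ht]
    convert G.chance_sum h hh ht
  | some k =>
    obtain ⟨a₀, ha₀⟩ := hh
    have h₀ : G.turn h = some k ∧ a₀ :: h ∈ G.hist := ⟨ht, ha₀⟩
    have hm := InfoSet.mem_actions (mem_members_infoAt h₀)
    rw [Finset.sum_subtype _ (p := fun a => a ∈ (infoAt h₀).actions)
      (fun a => by rw [hm a]; simp)]
    rw [← (σ k).sum_eq_one (infoAt h₀)]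
    refine Finset.sum_congr rfl fun a _ => ?_
    rw [moveProb_own σ ⟨ht, (hm a.1).1 a.2⟩]
    rfl

theorem reachFrom_nil_nonneg (σ : G.Profile) {z : List Act} (hz : z ∈ G.hist) :
    0 ≤ reachFrom σ [] z := by
  induction z with
  | nil => simp [reachFrom]
  | cons a z ih =>
    rw [reachFrom, if_neg (List.cons_ne_nil a z)]
    exact mul_nonneg (ih (G.tail_mem a z hz)) (moveProb_nonneg σ hz)

theorem reachOthers_nonneg (j : ι) (σ : G.Profile) {z : List Act} (hz : z ∈ G.hist) :
    0 ≤ reachOthers j σ z := by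
  induction z with
  | nil => simp [reachOthers]
  | cons a z ih =>
    rw [reachOthers]
    refine mul_nonneg (ih (G.tail_mem a z hz)) ?_
    split_ifs
    · exact zero_le_one
    · exact moveProb_nonneg σ hz

/-- The histories of length `n`, with the terminal histories that are shorter, form a cut of the
game tree, which is passed with probability one. -/
theorem sum_reachFrom_level (σ : G.Profile) (n : ℕ) :
    ∑ z ∈ G.hist.filter (fun z => z.length = n), reachFrom σ [] z +
      ∑ z ∈ G.terminals.filter (fun z => z.length < n), reachFrom σ [] z = 1 := by
  induction n with
  | zero =>
    have : G.hist.filter (fun z => z.length = 0) = {[]} := by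
      ext z
      simp only [Finset.mem_filter, List.length_eq_zero_iff, Finset.mem_singleton]
      exact ⟨fun h => h.2, fun h => ⟨h ▸ G.nil_mem, h⟩⟩
    rw [this]
    simp [reachFrom]
  | succ n ih =>
    have hstep : ∑ z ∈ G.hist.filter (fun z => z.length = n + 1), reachFrom σ [] z =
        ∑ h ∈ G.hist.filter (fun z => z.length = n),
          if ∃ a, a :: h ∈ G.hist then reachFrom σ [] h else 0 := by
      calc ∑ z ∈ G.hist.filter (fun z => z.length = n + 1), reachFrom σ [] z
          = ∑ x ∈ (G.hist.filter (fun z => z.length = n)).sigma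
              (fun h => Finset.univ.filter fun a => a :: h ∈ G.hist),
              reachFrom σ [] x.1 * moveProb σ x.1 x.2 := by
            refine (Finset.sum_bij (fun x _ => x.2 :: x.1) ?_ ?_ ?_ ?_).symm
            · rintro ⟨h, a⟩ hx
              simp only [Finset.mem_sigma, Finset.mem_filter, Finset.mem_univ, true_and] at hx ⊢
              exact ⟨hx.2, by simp [hx.1.2]⟩
            · rintro ⟨h, a⟩ _ ⟨h', a'⟩ _ heq
              obtain ⟨rfl, rfl⟩ := List.cons.inj heq
              rfl
            · intro z hz
              obtain ⟨hz, hl⟩ := Finset.mem_filter.1 hz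
              cases z with
              | nil => simp at hl
              | cons a h =>
                refine ⟨⟨h, a⟩, ?_, rfl⟩
                simp only [Finset.mem_sigma, Finset.mem_filter, Finset.mem_univ, true_and]
                exact ⟨⟨G.tail_mem a h hz, by simpa using hl⟩, hz⟩
            · rintro ⟨h, a⟩ _
              rw [reachFrom, if_neg (List.cons_ne_nil a h)]
        _ = _ := by
            rw [Finset.sum_sigma]
            refine Finset.sum_congr rfl fun h _ => ?_
            dsimp only
            rw [← Finset.mul_sum]
            split_ifs with hh
            · rw [sum_moveProb σ hh, mul_one]
            · rw [Finset.filter_false_of_mem fun a _ ha => hh ⟨a, ha⟩]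
              simp
    have hterm : ∑ z ∈ G.terminals.filter (fun z => z.length < n + 1), reachFrom σ [] z =
        ∑ z ∈ G.terminals.filter (fun z => z.length < n), reachFrom σ [] z +
        ∑ h ∈ G.hist.filter (fun z => z.length = n),
          if ∃ a, a :: h ∈ G.hist then 0 else reachFrom σ [] h := by
      simp only [terminals, Finset.sum_filter, ← Finset.sum_add_distrib]
      refine Finset.sum_congr rfl fun z _ => ?_
      by_cases hz : ∃ a, a :: z ∈ G.hist
      · simp [hz, not_forall.2 (by simpa using hz : ∃ a, ¬ a :: z ∉ G.hist)]
      · have hz' : ∀ a, a :: z ∉ G.hist := by simpa using hz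
        rcases lt_trichotomy z.length n with h | h | h
        · simp [hz', h, h.ne, h.trans (Nat.lt_succ_self n)]
        · simp [hz', h]
        · simp [hz', h.ne', h.not_gt, not_lt.2 (Nat.succ_le_of_lt h)]
    rw [hstep, hterm, ← ih, add_comm (∑ z ∈ G.terminals.filter _, _), ← add_assoc,
      ← Finset.sum_add_distrib]
    congr 1
    exact Finset.sum_congr rfl fun h _ => by split_ifs <;> simp

theorem sum_reachFrom_terminals_le_one (σ : G.Profile) :
    ∑ z ∈ G.terminals, reachFrom σ [] z ≤ 1 := by
  have h := sum_reachFrom_level σ (G.hist.sup List.length + 1)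
  rw [Finset.filter_true_of_mem (s := G.terminals)] at h
  · rw [← h]
    exact le_add_of_nonneg_left (Finset.sum_nonneg fun z hz =>
      reachFrom_nil_nonneg σ (Finset.mem_filter.1 hz).1)
  · intro z hz
    exact Nat.lt_succ_of_le (Finset.le_sup (f := List.length) (Finset.mem_filter.1 hz).1)

theorem reachFrom_nil_eq (σ : G.Profile) {z : List Act} (hz : z ∈ G.hist) :
    reachFrom σ [] z = reachOthers j σ z *
      ((G.experience j z).map fun x => ((σ j) x.1).1 x.2).prod := by
  induction z with
  | nil => simp [reachFrom, reachOthers, experience]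
  | cons a z ih =>
    rw [reachFrom, if_neg (List.cons_ne_nil a z), ih (G.tail_mem a z hz), reachOthers]
    by_cases ht : G.turn z = some j
    · rw [experience_cons_own ⟨ht, hz⟩, if_pos ht, List.map_cons, List.prod_cons,
        moveProb_own σ ⟨ht, hz⟩]
      ring
    · rw [experience_cons_other ht, if_neg ht]
      ring

/-- The strategy that plays towards `I` and the action `a` there with certainty, and elsewhere as
`p` does. -/
def playTowards (p : G.Strategy j) (I : G.InfoSet j) (a : I.Action) : G.Strategy j := fun J =>
  if h : ∃ b : J.Action, (⟨J, b⟩ : (J : G.InfoSet j) × J.Action) ∈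
      (⟨I, a⟩ : (J : G.InfoSet j) × J.Action) :: I.path then
    ⟨Pi.single h.choose 1, single_mem_stdSimplex ℝ h.choose⟩
  else p J

theorem Coherent.eq_of_fst_eq {l : List ((I : G.InfoSet j) × I.Action)} (hl : Coherent l)
    {x y : (I : G.InfoSet j) × I.Action} (hx : x ∈ l) (hy : y ∈ l) (hxy : x.1 = y.1) : x = y := by
  induction l with
  | nil => simp at hx
  | cons w l ih =>
    rcases List.mem_cons.1 hx with rfl | hx' <;> rcases List.mem_cons.1 hy with rfl | hy'
    · rfl
    · exact absurd hxy.symm (hl.fst_ne hy')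
    · exact absurd hxy (hl.fst_ne hx')
    · exact ih hl.2 hx' hy'

theorem playTowards_of_mem (hr : G.PerfectRecall j) (p : G.Strategy j) (I : G.InfoSet j)
    (a : I.Action) {x : (J : G.InfoSet j) × J.Action}
    (hx : x ∈ (⟨I, a⟩ : (J : G.InfoSet j) × J.Action) :: I.path) :
    (playTowards p I a x.1).1 x.2 = 1 := by
  have h : ∃ b : x.1.Action, (⟨x.1, b⟩ : (J : G.InfoSet j) × J.Action) ∈
    (⟨I, a⟩ : (J : G.InfoSet j) × J.Action) :: I.path := ⟨x.2, hx⟩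
  have hco : Coherent ((⟨I, a⟩ : (J : G.InfoSet j) × J.Action) :: I.path) :=
    ⟨rfl, coherent_path hr I⟩
  have heq : h.choose = x.2 := by
    have := hco.eq_of_fst_eq h.choose_spec hx rfl
    obtain ⟨J, c⟩ := x
    simpa using this
  rw [playTowards, dif_pos h]
  simp only
  rw [heq, Pi.single_eq_same]

theorem contProbAction_eq_zero (p : G.Strategy j) (I : G.InfoSet j) (a : I.Action)
    (l : List ((J : G.InfoSet j) × J.Action)) (hI : ∀ x ∈ l, x.1 ≠ I) :
    contProbAction p I a l = 0 := by
  induction l with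
  | nil => rfl
  | cons x l ih =>
    rw [contProbAction, if_neg, ih fun y hy => hI y (List.mem_cons_of_mem _ hy)]
    · simp
    · rintro rfl
      exact hI _ List.mem_cons_self rfl

theorem contProbAction_nonneg (p : G.Strategy j) (I : G.InfoSet j) (a : I.Action)
    (l : List ((J : G.InfoSet j) × J.Action)) : 0 ≤ contProbAction p I a l := by
  induction l with
  | nil => exact le_rfl
  | cons x l ih =>
    rw [contProbAction]
    exact add_nonneg (by split_ifs <;> simp) (mul_nonneg ih (p.nonneg _ _))

/-- At most one visit of a coherent line to `I` counts, and before it `playTowards` follows the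
line with certainty. -/
theorem contProbAction_le_prod (hr : G.PerfectRecall j) (p : G.Strategy j) (I : G.InfoSet j)
    (a : I.Action) {l : List ((J : G.InfoSet j) × J.Action)} (hl : Coherent l) :
    contProbAction p I a l ≤ (l.map fun x => (playTowards p I a x.1).1 x.2).prod := by
  have hnn : ∀ l : List ((J : G.InfoSet j) × J.Action),
      0 ≤ (l.map fun x => (playTowards p I a x.1).1 x.2).prod := fun l =>
    List.prod_nonneg fun b hb => by
      obtain ⟨x, -, rfl⟩ := List.mem_map.1 hb
      exact Strategy.nonneg _ _ _
  induction l with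
  | nil => simp [contProbAction]
  | cons x l ih =>
    by_cases hx : x = ⟨I, a⟩
    · obtain ⟨hp, hl⟩ := hl
      subst hx
      dsimp only at hp
      subst hp
      rw [contProbAction, if_pos rfl,
        contProbAction_eq_zero _ _ _ _ fun y hy h => not_before_self hr I ⟨y, hy, h⟩,
        List.prod_eq_one]
      · simp
      · intro b hb
        obtain ⟨x, hx, rfl⟩ := List.mem_map.1 hb
        exact playTowards_of_mem hr p I a hx
    rw [contProbAction, if_neg hx, zero_add]
    by_cases hI : ∃ y ∈ l, y.1 = I
    · obtain ⟨y, hy, rfl⟩ := hI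
      have hpt : playTowards p y.1 a x.1 = p x.1 := by
        rw [playTowards, dif_neg]
        rintro ⟨b, hb⟩
        rcases List.mem_cons.1 hb with hb | hb
        · exact hl.fst_ne hy (congrArg Sigma.fst hb).symm
        · exact hl.fst_ne ((hl.2.path_suffix hy).subset (List.mem_cons_of_mem _ hb)) rfl
      rw [List.map_cons, List.prod_cons, hpt, mul_comm]
      exact mul_le_mul_of_nonneg_left (ih hl.2) (p.nonneg _ _)
    · rw [contProbAction_eq_zero _ _ _ _ fun y hy h => hI ⟨y, hy, h⟩, zero_mul]
      exact hnn _

theorem nonneg_of_utility_bound {U : ℝ} (hU : ∀ z ∈ G.terminals, |G.utility j z| ≤ U) :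
    0 ≤ U := by
  obtain ⟨z, hz, hmax⟩ := Finset.exists_max_image G.hist List.length ⟨[], G.nil_mem⟩
  refine (abs_nonneg _).trans (hU z (Finset.mem_filter.2 ⟨hz, fun a ha => ?_⟩))
  have := hmax _ ha
  simp at this

theorem abs_cfValueAction_le (hr : G.PerfectRecall j) {U : ℝ}
    (hU : ∀ z ∈ G.terminals, |G.utility j z| ≤ U) (σ : G.Profile) (I : G.InfoSet j)
    (a : I.Action) : |cfValueAction σ I a| ≤ U := by
  have hU0 := nonneg_of_utility_bound hU
  -- Replacing the strategy of `j` on the way to `a` by one that plays towards `a` turns the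
  -- weights of the terminal histories into probabilities.
  set τ : G.Profile := Function.update σ j (playTowards (σ j) I a) with hτ
  rw [cfValueAction_eq_sum_terminals]
  calc |∑ z ∈ G.terminals, reachOthers j σ z * G.utility j z *
        contProbAction (σ j) I a (G.experience j z)|
      ≤ ∑ z ∈ G.terminals, |reachOthers j σ z * G.utility j z *
        contProbAction (σ j) I a (G.experience j z)| := Finset.abs_sum_le_sum_abs _ _
    _ ≤ ∑ z ∈ G.terminals, U * reachFrom τ [] z := by
        refine Finset.sum_le_sum fun z hz => ?_
        have hzh := (Finset.mem_filter.1 hz).1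
        have hR := reachOthers_nonneg j σ hzh
        have hc := contProbAction_nonneg (σ j) I a (G.experience j z)
        rw [reachFrom_nil_eq (j := j) τ hzh, hτ, reachOthers_update, Function.update_self,
          abs_mul, abs_mul, abs_of_nonneg hR, abs_of_nonneg hc]
        calc reachOthers j σ z * |G.utility j z| * contProbAction (σ j) I a (G.experience j z)
            ≤ reachOthers j σ z * U * contProbAction (σ j) I a (G.experience j z) := by
              gcongr
              exact hU z hz
          _ ≤ reachOthers j σ z * U *
              ((G.experience j z).map fun x => (playTowards (σ j) I a x.1).1 x.2).prod := by
              gcongr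
              exact contProbAction_le_prod hr _ _ _ (coherent_experience hr z)
          _ = _ := by ring
    _ ≤ U := by
        rw [← Finset.mul_sum]
        exact mul_le_of_le_one_right hU0 (sum_reachFrom_terminals_le_one τ)

/-- The squared regret is bounded linearly in the probability of the actions that `f` moves, so
that summing over `f` brings in the maximal activation. -/
theorem cfRegret_sq_le (hr : G.PerfectRecall j) {U : ℝ}
    (hU : ∀ z ∈ G.terminals, |G.utility j z| ≤ U) (σ : G.Profile) (I : G.InfoSet j)
    (f : I.Action → I.Action) :
    cfRegret σ I f ^ 2 ≤ (2 * U) ^ 2 * ∑ a, (σ j I).1 a * if f a ≠ a then 1 else 0 := by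
  have hU0 := nonneg_of_utility_bound hU
  set m : ℝ := ∑ a, (σ j I).1 a * if f a ≠ a then 1 else 0 with hm
  have hm0 : 0 ≤ m := Finset.sum_nonneg fun a _ =>
    mul_nonneg ((σ j).nonneg _ _) (by split_ifs <;> simp)
  have hm1 : m ≤ 1 := by
    rw [← (σ j).sum_eq_one I]
    refine Finset.sum_le_sum fun a _ => mul_le_of_le_one_right ((σ j).nonneg _ _) ?_
    split_ifs <;> simp
  have habs : |cfRegret σ I f| ≤ 2 * U * m := by
    rw [cfRegret_eq_sum, hm, Finset.mul_sum]
    refine (Finset.abs_sum_le_sum_abs _ _).trans (Finset.sum_le_sum fun a _ => ?_)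
    rw [abs_mul, abs_of_nonneg ((σ j).nonneg _ _)]
    by_cases h : f a = a
    · simp [h]
    · rw [if_pos h, mul_one, mul_comm (2 * U)]
      refine mul_le_mul_of_nonneg_left ?_ ((σ j).nonneg _ _)
      have h1 := abs_le.1 (abs_cfValueAction_le hr hU σ I (f a))
      have h2 := abs_le.1 (abs_cfValueAction_le hr hU σ I a)
      rw [abs_le]
      constructor <;> linarith [h1.1, h1.2, h2.1, h2.2]
  calc cfRegret σ I f ^ 2 = |cfRegret σ I f| ^ 2 := (sq_abs _).symm
    _ ≤ (2 * U * m) ^ 2 := by gcongr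
    _ = (2 * U) ^ 2 * (m * m) := by ring
    _ ≤ (2 * U) ^ 2 * m := by
        gcongr
        exact mul_le_of_le_one_right hm0 hm1

/-! ### Regret matching with time selection -/

/-- The memory probabilities only depend on the finitely many transformations that the deviation
uses along the line. -/
theorem finite_memProbAux (l : List ((J : G.InfoSet j) × J.Action)) (g : Memory Act) :
    {w : G.Strategy j → ℝ | ∃ φ : G.BehDev j, w = fun p => φ.memProbAux p l g}.Finite := by
  induction l generalizing g with
  | nil =>
    refine (Set.finite_singleton (fun _ : G.Strategy j => if g = [] then (1 : ℝ) else 0)).subset ?_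
    rintro w ⟨φ, rfl⟩
    cases g <;> simp [BehDev.memProbAux]
  | cons x l ih =>
    cases g with
    | nil =>
      refine (Set.finite_singleton (fun _ : G.Strategy j => (0 : ℝ))).subset ?_
      rintro w ⟨φ, rfl⟩
      simp [BehDev.memProbAux]
    | cons b g =>
      refine (Set.Finite.image2 (fun (w : G.Strategy j → ℝ) (f : x.1.Action → x.1.Action) p =>
        w p * ∑ a : x.1.Action, if f a = x.2 ∧ observe f a = b then (p x.1).1 a else 0)
        (ih g) Set.finite_univ).subset ?_
      rintro w ⟨φ, rfl⟩
      exact ⟨_, ⟨φ, rfl⟩, (φ x.1 g).1, Set.mem_univ _, rfl⟩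

theorem BehDev.length_of_realizable {φ : G.BehDev j} {I : G.InfoSet j} {g : Memory Act}
    (hg : g ∈ φ.realizable I) : g.length = I.path.length := by
  obtain ⟨s, hs⟩ := hg
  by_contra h
  rw [memProb, memProbAux_eq_zero_of_length_ne _ _ _ _ h] at hs
  exact zero_ne_one hs

theorem finite_timeSelection (Φ : Set (G.BehDev j)) (I : G.InfoSet j)
    (f : I.Action → I.Action) : (timeSelection Φ I f).Finite := by
  refine ((memories Act I.path.length).finite_toSet.biUnion
    fun g _ => finite_memProbAux (j := j) I.path g).subset ?_
  rintro w ⟨φ, -, g, hg, -, rfl⟩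
  refine Set.mem_biUnion (mem_memories.2 (BehDev.length_of_realizable hg)) ⟨φ, rfl⟩

theorem timeSelection_nonneg {Φ : Set (G.BehDev j)} {I : G.InfoSet j}
    {f : I.Action → I.Action} {w : G.Strategy j → ℝ} (hw : w ∈ timeSelection Φ I f)
    (p : G.Strategy j) : 0 ≤ w p := by
  obtain ⟨φ, -, g, -, -, rfl⟩ := hw
  exact φ.memProbAux_nonneg p _ _

theorem timeSelection_le_one {Φ : Set (G.BehDev j)} {I : G.InfoSet j}
    {f : I.Action → I.Action} {w : G.Strategy j → ℝ} (hw : w ∈ timeSelection Φ I f)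
    (p : G.Strategy j) : w p ≤ 1 := by
  obtain ⟨φ, -, g, -, -, rfl⟩ := hw
  exact φ.memProbAux_le_one p _ _

theorem linkOutput_eq_sum (Φ : Set (G.BehDev j)) (σ : ℕ → G.Profile) (I : G.InfoSet j) (t : ℕ)
    (f : I.Action → I.Action) :
    linkOutput Φ σ I t f = ∑ w ∈ (finite_timeSelection Φ I f).toFinset,
      w (σ t j) * max (cumRegret σ I f w t) 0 :=
  finsum_mem_eq_finite_toFinset_sum _ _

theorem linkOutput_nonneg (Φ : Set (G.BehDev j)) (σ : ℕ → G.Profile) (I : G.InfoSet j) (t : ℕ)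
    (f : I.Action → I.Action) : 0 ≤ linkOutput Φ σ I t f := by
  rw [linkOutput_eq_sum]
  refine Finset.sum_nonneg fun w hw => mul_nonneg ?_ (le_max_right _ _)
  exact timeSelection_nonneg ((Set.Finite.mem_toFinset _).1 hw) _

theorem sum_mul_cfRegretAction (σ : G.Profile) (I : G.InfoSet j) :
    ∑ a, (σ j I).1 a * cfRegretAction σ I a = 0 := by
  simp only [cfRegretAction, mul_sub, Finset.sum_sub_distrib]
  rw [← Finset.sum_mul, (σ j).sum_eq_one, one_mul, sub_self]

/-- Blackwell's condition: at a fixed point of the regret matching operator the immediate regrets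
are orthogonal to the link outputs. -/
theorem sum_linkOutput_mul_cfRegret {Φ : Set (G.BehDev j)} {σ : ℕ → G.Profile}
    (hσ : FollowsEFR Φ σ) (t : ℕ) (I : G.InfoSet j) :
    ∑ f ∈ transformations Φ I, linkOutput Φ σ I t f * cfRegret (σ t) I f = 0 := by
  have hnn : 0 ≤ linkSum Φ σ I t := Finset.sum_nonneg fun f _ => linkOutput_nonneg Φ σ I t f
  rcases hnn.eq_or_lt with h0 | hpos
  · refine Finset.sum_eq_zero fun f hf => ?_
    rw [(Finset.sum_eq_zero_iff_of_nonneg fun f _ => linkOutput_nonneg Φ σ I t f).1 h0.symm f hf,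
      zero_mul]
  · have hfix : ∀ a, ∑ f ∈ transformations Φ I,
        linkOutput Φ σ I t f * pushWeights f (σ t j I).1 a =
        linkSum Φ σ I t * (σ t j I).1 a := fun a => by
      rw [← hσ t I hpos a]
      field_simp
    unfold cfRegret
    simp only [Finset.mul_sum]
    rw [Finset.sum_comm]
    simp only [← mul_assoc]
    simp only [← Finset.sum_mul, hfix]
    simp only [mul_assoc]
    rw [← Finset.mul_sum, sum_mul_cfRegretAction, mul_zero]

theorem sum_ncard_timeSelection_le (Φ : Set (G.BehDev j)) (I : G.InfoSet j) (a : I.Action) :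
    ∑ f ∈ (transformations Φ I).filter (fun f => f a ≠ a), (timeSelection Φ I f).ncard ≤
      bigD Φ := by
  set S := (transformations Φ I).filter (fun f => f a ≠ a) with hS
  rcases S.eq_empty_or_nonempty with h | h
  · simp [h]
  have hact : S.card ≤ maxActivation Φ I :=
    Finset.le_sup (f := fun a : I.Action => ((transformations Φ I).filter fun f => f a ≠ a).card)
      (Finset.mem_univ a)
  have hD : ∀ f ∈ S, (timeSelection Φ I f).ncard * maxActivation Φ I ≤ bigD Φ := fun f hf =>
    (Finset.le_sup (f := fun f => (timeSelection Φ I f).ncard * maxActivation Φ I)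
      (Finset.mem_filter.1 hf).1).trans
      (Finset.le_sup (f := fun I : G.InfoSet j => (transformations Φ I).sup fun f =>
        (timeSelection Φ I f).ncard * maxActivation Φ I) (Finset.mem_univ I))
  refine Nat.le_of_mul_le_mul_left ?_ h.card_pos
  calc S.card * ∑ f ∈ S, (timeSelection Φ I f).ncard
      = ∑ f ∈ S, (timeSelection Φ I f).ncard * S.card := by rw [← Finset.sum_mul, mul_comm]
    _ ≤ ∑ f ∈ S, bigD Φ :=
        Finset.sum_le_sum fun f hf => (Nat.mul_le_mul_left _ hact).trans (hD f hf)
    _ = S.card * bigD Φ := by simp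

/-- The second-order term in the growth of the regret potential. -/
theorem sum_sq_le (hr : G.PerfectRecall j) {U : ℝ}
    (hU : ∀ z ∈ G.terminals, |G.utility j z| ≤ U) (Φ : Set (G.BehDev j)) (τ : G.Profile)
    (I : G.InfoSet j) :
    ∑ f ∈ transformations Φ I, ∑ w ∈ (finite_timeSelection Φ I f).toFinset,
      (w (τ j) * cfRegret τ I f) ^ 2 ≤ (2 * U) ^ 2 * bigD Φ := by
  calc ∑ f ∈ transformations Φ I, ∑ w ∈ (finite_timeSelection Φ I f).toFinset,
      (w (τ j) * cfRegret τ I f) ^ 2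
      ≤ ∑ f ∈ transformations Φ I, ((timeSelection Φ I f).ncard : ℝ) *
          ((2 * U) ^ 2 * ∑ a, (τ j I).1 a * if f a ≠ a then 1 else 0) := by
        refine Finset.sum_le_sum fun f _ => ?_
        rw [Set.ncard_eq_toFinset_card _ (finite_timeSelection Φ I f), ← nsmul_eq_mul]
        refine Finset.sum_le_card_nsmul _ _ _ fun w hw => ?_
        have hw := (Set.Finite.mem_toFinset _).1 hw
        refine le_trans ?_ (cfRegret_sq_le hr hU τ I f)
        rw [mul_pow]
        exact mul_le_of_le_one_left (sq_nonneg _)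
          (pow_le_one₀ (timeSelection_nonneg hw _) (timeSelection_le_one hw _))
    _ = (2 * U) ^ 2 * ∑ a, (τ j I).1 a *
          ((∑ f ∈ (transformations Φ I).filter (fun f => f a ≠ a),
            (timeSelection Φ I f).ncard : ℕ) : ℝ) := by
        push_cast
        simp only [Finset.sum_filter, Finset.mul_sum]
        rw [Finset.sum_comm]
        refine Finset.sum_congr rfl fun a _ => Finset.sum_congr rfl fun f _ => ?_
        split_ifs <;> ring
    _ ≤ (2 * U) ^ 2 * ∑ a, (τ j I).1 a * (bigD Φ : ℝ) := by
        gcongr with a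
        · exact (τ j).nonneg _ _
        · exact sum_ncard_timeSelection_le Φ I a
    _ = (2 * U) ^ 2 * bigD Φ := by
        rw [← Finset.sum_mul, (τ j).sum_eq_one, one_mul]

theorem max_add_zero_sq_le (x y : ℝ) :
    max (x + y) 0 ^ 2 ≤ max x 0 ^ 2 + 2 * (max x 0 * y) + y ^ 2 := by
  have h : max (x + y) 0 ≤ |max x 0 + y| :=
    max_le ((add_le_add_left (le_max_left x 0) y).trans (le_abs_self _)) (abs_nonneg _)
  calc max (x + y) 0 ^ 2 ≤ |max x 0 + y| ^ 2 := by
        gcongr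
    _ = _ := by rw [sq_abs]; ring

theorem sum_sq_cumRegret_le (hr : G.PerfectRecall j) {U : ℝ}
    (hU : ∀ z ∈ G.terminals, |G.utility j z| ≤ U) {Φ : Set (G.BehDev j)} {σ : ℕ → G.Profile}
    (hσ : FollowsEFR Φ σ) (I : G.InfoSet j) (T : ℕ) :
    ∑ f ∈ transformations Φ I, ∑ w ∈ (finite_timeSelection Φ I f).toFinset,
      max (cumRegret σ I f w T) 0 ^ 2 ≤ T * ((2 * U) ^ 2 * bigD Φ) := by
  induction T with
  | zero => simp [cumRegret]
  | succ t ih =>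
    have hcross : ∑ f ∈ transformations Φ I, ∑ w ∈ (finite_timeSelection Φ I f).toFinset,
        max (cumRegret σ I f w t) 0 * (w (σ t j) * cfRegret (σ t) I f) = 0 := by
      refine Eq.trans ?_ (sum_linkOutput_mul_cfRegret hσ t I)
      refine Finset.sum_congr rfl fun f _ => ?_
      rw [linkOutput_eq_sum, Finset.sum_mul]
      exact Finset.sum_congr rfl fun w _ => by ring
    calc ∑ f ∈ transformations Φ I, ∑ w ∈ (finite_timeSelection Φ I f).toFinset,
        max (cumRegret σ I f w (t + 1)) 0 ^ 2
        ≤ ∑ f ∈ transformations Φ I, ∑ w ∈ (finite_timeSelection Φ I f).toFinset,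
          (max (cumRegret σ I f w t) 0 ^ 2 +
            2 * (max (cumRegret σ I f w t) 0 * (w (σ t j) * cfRegret (σ t) I f)) +
            (w (σ t j) * cfRegret (σ t) I f) ^ 2) := by
          refine Finset.sum_le_sum fun f _ => Finset.sum_le_sum fun w _ => ?_
          rw [cumRegret, Finset.sum_range_succ]
          exact max_add_zero_sq_le _ _
      _ ≤ t * ((2 * U) ^ 2 * bigD Φ) + 2 * 0 + (2 * U) ^ 2 * bigD Φ := by
          simp only [Finset.sum_add_distrib, ← Finset.mul_sum]
          rw [hcross]
          gcongr
          exact sum_sq_le hr hU Φ (σ t) I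
      _ = (t + 1 : ℕ) * ((2 * U) ^ 2 * bigD Φ) := by
          push_cast
          ring

/-- The cumulative immediate regret bound of exact regret matching. -/
theorem cumRegret_le (hr : G.PerfectRecall j) {U : ℝ}
    (hU : ∀ z ∈ G.terminals, |G.utility j z| ≤ U) {Φ : Set (G.BehDev j)} {σ : ℕ → G.Profile}
    (hσ : FollowsEFR Φ σ) (I : G.InfoSet j) {f : I.Action → I.Action}
    {w : G.Strategy j → ℝ} (hw : w ∈ timeSelection Φ I f) (T : ℕ) :
    cumRegret σ I f w T ≤ 2 * U * Real.sqrt ((bigD Φ : ℝ) * (T : ℝ)) := by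
  have hU0 := nonneg_of_utility_bound hU
  have hf : f ∈ transformations Φ I := by
    obtain ⟨φ, hφ, g, hg, hfg, -⟩ := hw
    exact Finset.mem_filter.2 ⟨Finset.mem_univ _, φ, hφ, g, hg, hfg⟩
  have h1 : max (cumRegret σ I f w T) 0 ^ 2 ≤ T * ((2 * U) ^ 2 * bigD Φ) := by
    refine le_trans ?_ (sum_sq_cumRegret_le hr hU hσ I T)
    refine le_trans ?_ (Finset.single_le_sum (fun f _ => Finset.sum_nonneg
      fun w _ => sq_nonneg (max (cumRegret σ I f w T) 0)) hf)
    exact Finset.single_le_sum (f := fun w => max (cumRegret σ I f w T) 0 ^ 2)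
      (fun w _ => sq_nonneg _) ((Set.Finite.mem_toFinset _).2 hw)
  refine (le_max_left _ 0).trans ?_
  refine abs_le_of_sq_le_sq' ?_ (by positivity) |>.2
  rw [mul_pow, Real.sq_sqrt (by positivity)]
  linarith

/-! ### Counting realizable memory states -/

/-- Given the transformation and the action it produces, at most two observations are possible,
and only one unless the transformation is internal but neither external nor the identity. -/
theorem card_observations_le {I : G.InfoSet j} (f : I.Action → I.Action)
    (hf : f = id ∨ IsExternal f ∨ IsInternal f) (c : I.Action) :
    (Finset.univ.filter fun b : Option Act => ∃ a, f a = c ∧ observe f a = b).card ≤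
      2 ^ (if IsInternal f ∧ ¬ IsExternal f ∧ f ≠ id then 1 else 0) := by
  by_cases hext : IsExternal f
  · rw [if_neg fun h => h.2.1 hext, pow_zero]
    refine (Finset.card_le_card (t := {none}) fun b hb => ?_).trans (Finset.card_singleton _).le
    obtain ⟨a, -, rfl⟩ := (Finset.mem_filter.1 hb).2
    simp [observe, hext]
  · by_cases hid : f = id
    · rw [if_neg fun h => h.2.2 hid, pow_zero]
      refine (Finset.card_le_card (t := {some c.1}) fun b hb => ?_).trans
        (Finset.card_singleton _).le
      obtain ⟨a, hac, rfl⟩ := (Finset.mem_filter.1 hb).2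
      rw [observe, if_neg hext, ← hac, hid]
      simp
    · have hint : IsInternal f := (hf.resolve_left hid).resolve_left hext
      rw [if_pos ⟨hint, hext, hid⟩, pow_one]
      obtain ⟨x, y, hxy⟩ := hint
      refine (Finset.card_le_card (t := {some x.1, some c.1}) fun b hb => ?_).trans
        Finset.card_le_two
      obtain ⟨a, hac, rfl⟩ := (Finset.mem_filter.1 hb).2
      rw [observe, if_neg hext]
      by_cases hax : a = x
      · simp [hax]
      · have hfa : f a = a := by
          rw [hxy]
          exact dif_neg hax
        rw [hfa] at hac
        simp [← hac]

/-- A Kraft-type inequality for the memory states that a deviation can realize along a line. -/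
theorem sum_realizable_pow_internalCount_le_one (φ : G.BehDev j)
    (l : List ((J : G.InfoSet j) × J.Action)) :
    ∑ g ∈ memories Act l.length,
      (if ∃ s : G.Pure j, φ.memProbAux s.toStrategy l g = 1 then
        (1 / 2 : ℝ) ^ φ.internalCount l g else 0) ≤ 1 := by
  induction l with
  | nil =>
    rw [List.length_nil, sum_memories_zero]
    split_ifs <;> simp [BehDev.internalCount]
  | cons x l ih =>
    rw [List.length_cons, sum_memories_succ]
    refine le_trans (Finset.sum_le_sum fun g _ => ?_) ih
    set f := (φ x.1 g).1 with hf
    set k : ℕ := if IsInternal f ∧ ¬ IsExternal f ∧ f ≠ id then 1 else 0 with hk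
    have hreal : ∀ b, (∃ s : G.Pure j, φ.memProbAux s.toStrategy (x :: l) (b :: g) = 1) →
        (∃ s : G.Pure j, φ.memProbAux s.toStrategy l g = 1) ∧
          ∃ a, f a = x.2 ∧ observe f a = b := by
      rintro b ⟨s, hs⟩
      rw [BehDev.memProbAux_pure_cons] at hs
      split_ifs at hs with h
      · exact ⟨⟨s, by simpa using hs⟩, _, h⟩
      · simp at hs
    by_cases hg : ∃ s : G.Pure j, φ.memProbAux s.toStrategy l g = 1
    · rw [if_pos hg]
      calc ∑ b : Option Act, (if ∃ s : G.Pure j, φ.memProbAux s.toStrategy (x :: l) (b :: g) = 1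
            then (1 / 2 : ℝ) ^ φ.internalCount (x :: l) (b :: g) else 0)
          ≤ ∑ b : Option Act, if ∃ a, f a = x.2 ∧ observe f a = b
            then (1 / 2 : ℝ) ^ (φ.internalCount l g + k) else 0 := by
            refine Finset.sum_le_sum fun b _ => ?_
            by_cases hb : ∃ s : G.Pure j, φ.memProbAux s.toStrategy (x :: l) (b :: g) = 1
            · rw [if_pos hb, if_pos (hreal b hb).2]
              rfl
            · rw [if_neg hb]
              split_ifs <;> positivity
        _ = (Finset.univ.filter fun b : Option Act => ∃ a, f a = x.2 ∧ observe f a = b).card *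
              (1 / 2 : ℝ) ^ (φ.internalCount l g + k) := by
            rw [← Finset.sum_filter, Finset.sum_const, nsmul_eq_mul]
        _ ≤ 2 ^ k * (1 / 2 : ℝ) ^ (φ.internalCount l g + k) := by
            gcongr
            exact_mod_cast card_observations_le f (φ x.1 g).2 x.2
        _ = (1 / 2 : ℝ) ^ φ.internalCount l g := by
            rw [pow_add, mul_comm, mul_assoc, ← mul_pow]
            norm_num
    · rw [if_neg hg]
      refine (Finset.sum_eq_zero fun b _ => if_neg fun hb => hg (hreal b hb).1).le

theorem internalCount_le_length (φ : G.BehDev j) (l : List ((J : G.InfoSet j) × J.Action))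
    (g : Memory Act) : φ.internalCount l g ≤ l.length := by
  induction l generalizing g with
  | nil => cases g <;> simp [BehDev.internalCount]
  | cons x l ih =>
    cases g with
    | nil => simp [BehDev.internalCount]
    | cons b g =>
      rw [BehDev.internalCount, List.length_cons]
      exact Nat.add_le_add (ih g) (by split_ifs <;> simp)

theorem internalCount_le_nIN {Φ : Set (G.BehDev j)} {φ : G.BehDev j} (hφ : φ ∈ Φ)
    {I : G.InfoSet j} {g : Memory Act} (hg : g ∈ φ.realizable I) (hid : (φ I g).1 ≠ id) :
    φ.internalCount I.path g ≤ nIN Φ := by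
  refine le_csSup ⟨Finset.univ.sup fun I : G.InfoSet j => I.path.length, ?_⟩
    ⟨φ, hφ, I, g, hg, hid, rfl⟩
  rintro n ⟨ψ, -, J, g', -, -, rfl⟩
  exact (internalCount_le_length ψ _ _).trans
    (Finset.le_sup (f := fun I : G.InfoSet j => I.path.length) (Finset.mem_univ J))

/-! ### Regret bounds -/

/-- At every information set and memory state where `ψ` acts, it agrees, including the way in
which the memory state was built up, with a member of `Φ`. This holds for the members of `Φ` and
for their truncations. -/
def BehDev.CoveredBy (ψ : G.BehDev j) (Φ : Set (G.BehDev j)) : Prop :=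
  ∀ (I : G.InfoSet j) (g : Memory Act), g ∈ ψ.realizable I → (ψ I g).1 ≠ id →
    ∃ φ ∈ Φ, ψ I g = φ I g ∧ ψ.memProb I g = φ.memProb I g ∧
      ψ.internalCount I.path g = φ.internalCount I.path g

theorem BehDev.coveredBy_of_mem {Φ : Set (G.BehDev j)} {φ : G.BehDev j} (hφ : φ ∈ Φ) :
    φ.CoveredBy Φ :=
  fun _ _ _ _ => ⟨φ, hφ, rfl, rfl, rfl⟩

theorem BehDev.internalCount_upTo (φ : G.BehDev j) (I : G.InfoSet j)
    (l : List ((J : G.InfoSet j) × J.Action)) (hl : ∀ x ∈ l, x.1.BeforeEq I) (g : Memory Act) :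
    (φ.upTo I).internalCount l g = φ.internalCount l g := by
  induction l generalizing g with
  | nil => cases g <;> rfl
  | cons x l ih =>
    cases g with
    | nil => rfl
    | cons b g =>
      rw [internalCount, internalCount, ih fun y hy => hl y (List.mem_cons_of_mem _ hy), upTo,
        if_pos (hl x List.mem_cons_self)]

theorem BehDev.coveredBy_upTo (hr : G.PerfectRecall j) {Φ : Set (G.BehDev j)} {φ : G.BehDev j}
    (hφ : φ ∈ Φ) (J : G.InfoSet j) : (φ.upTo J).CoveredBy Φ := by
  intro I g _ hid
  by_cases hI : I.BeforeEq J
  · refine ⟨φ, hφ, if_pos hI, ?_, φ.internalCount_upTo J _ (hI.path_beforeEq hr) g⟩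
    funext p
    exact φ.memProbAux_upTo J p _ (hI.path_beforeEq hr) g
  · rw [upTo, if_neg hI] at hid
    exact absurd rfl hid

theorem BehDev.CoveredBy.card_active_le {Φ : Set (G.BehDev j)} {ψ : G.BehDev j}
    (hψ : ψ.CoveredBy Φ) (I : G.InfoSet j) :
    (((memories Act I.path.length).filter
      fun g => g ∈ ψ.realizable I ∧ (ψ I g).1 ≠ id).card : ℝ) ≤ 2 ^ nIN Φ := by
  have h : (((memories Act I.path.length).filter
      fun g => g ∈ ψ.realizable I ∧ (ψ I g).1 ≠ id).card : ℝ) * (1 / 2) ^ nIN Φ ≤ 1 := by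
    refine le_trans ?_ (sum_realizable_pow_internalCount_le_one ψ I.path)
    rw [← nsmul_eq_mul, ← Finset.sum_const, Finset.sum_filter]
    refine Finset.sum_le_sum fun g _ => ?_
    by_cases hg : g ∈ ψ.realizable I ∧ (ψ I g).1 ≠ id
    · have hg' : ∃ s : G.Pure j, ψ.memProbAux s.toStrategy I.path g = 1 := hg.1
      rw [if_pos hg, if_pos hg']
      refine pow_le_pow_of_le_one (by norm_num) (by norm_num) ?_
      obtain ⟨φ, hφ, hact, hprob, hcount⟩ := hψ I g hg.1 hg.2
      rw [hcount]
      refine internalCount_le_nIN hφ ?_ (hact ▸ hg.2)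
      obtain ⟨s, hs⟩ := hg.1
      exact ⟨s, hprob ▸ hs⟩
    · rw [if_neg hg]
      split_ifs <;> positivity
  rwa [one_div, inv_pow, ← div_eq_mul_inv, div_le_one (by positivity)] at h

theorem cfRegret_id (σ : G.Profile) (I : G.InfoSet j) : cfRegret σ I id = 0 := by
  simp [cfRegret_eq_sum]

/-- One term of the decomposition: it vanishes unless the memory state is realizable and the
transformation is not the identity, in which case regret matching bounds it. -/
theorem BehDev.CoveredBy.sum_weighted_cfRegret_le (hr : G.PerfectRecall j) {U : ℝ}
    (hU : ∀ z ∈ G.terminals, |G.utility j z| ≤ U) {Φ : Set (G.BehDev j)} {σ : ℕ → G.Profile}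
    (hσ : FollowsEFR Φ σ) {ψ : G.BehDev j} (hψ : ψ.CoveredBy Φ) (I : G.InfoSet j)
    (g : Memory Act) (T : ℕ) :
    ∑ t ∈ Finset.range T, ψ.memProb I g (σ t j) * cfRegret (σ t) I (ψ I g).1 ≤
      if g ∈ ψ.realizable I ∧ (ψ I g).1 ≠ id then
        2 * U * Real.sqrt ((bigD Φ : ℝ) * (T : ℝ)) else 0 := by
  by_cases hg : g ∈ ψ.realizable I
  · by_cases hid : (ψ I g).1 = id
    · rw [if_neg fun h => h.2 hid]
      simp [hid, cfRegret_id]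
    · rw [if_pos ⟨hg, hid⟩]
      obtain ⟨φ, hφ, hact, hprob, -⟩ := hψ I g hg hid
      refine cumRegret_le hr hU hσ I (w := ψ.memProb I g) ⟨φ, hφ, g, ?_, by rw [hact], hprob⟩ T
      obtain ⟨s, hs⟩ := hg
      exact ⟨s, hprob ▸ hs⟩
  · rw [if_neg fun h => hg h.1]
    simp [ψ.memProb_eq_zero_of_not_realizable hr I g hg]

theorem sum_suffix_indicator_le_one (S : Finset (Memory Act)) (n : ℕ) (hS : S ⊆ memories Act n)
    (P : Prop) (g' : Memory Act) :
    ∑ g ∈ S, (if P ∧ g <:+ g' then (1 : ℝ) else 0) ≤ 1 := by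
  calc ∑ g ∈ S, (if P ∧ g <:+ g' then (1 : ℝ) else 0)
      ≤ ∑ g ∈ S, if g = g'.drop (g'.length - n) then (1 : ℝ) else 0 := by
        refine Finset.sum_le_sum fun g hg => ?_
        by_cases h : P ∧ g <:+ g'
        · rw [if_pos h, if_pos]
          rw [← mem_memories.1 (hS hg)]
          exact List.suffix_iff_eq_drop.1 h.2
        · rw [if_neg h]
          split_ifs <;> simp
    _ ≤ 1 := by
        rw [Finset.sum_ite_eq']
        split_ifs <;> simp

/-- The cumulative full regret from `I`, summed over any set of memory states in `I`. The bounds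
for a single memory state and for the full regret of the swap deviation are both instances. -/
theorem BehDev.CoveredBy.sum_memFullRegret_le (hr : G.PerfectRecall j) {U : ℝ}
    (hU : ∀ z ∈ G.terminals, |G.utility j z| ≤ U) {Φ : Set (G.BehDev j)} {σ : ℕ → G.Profile}
    (hσ : FollowsEFR Φ σ) {ψ : G.BehDev j} (hψ : ψ.CoveredBy Φ) (I : G.InfoSet j)
    (S : Finset (Memory Act)) (hS : S ⊆ memories Act I.path.length) (T : ℕ) :
    ∑ t ∈ Finset.range T, ∑ g ∈ S, ψ.memFullRegret I g (σ t) ≤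
      2 ^ (nIN Φ + 1) * U * ((G.infosets j).card : ℝ) *
        Real.sqrt ((bigD Φ : ℝ) * (T : ℝ)) := by
  have hU0 := nonneg_of_utility_bound hU
  set B : ℝ := 2 * U * Real.sqrt ((bigD Φ : ℝ) * (T : ℝ)) with hB
  have hB0 : 0 ≤ B := by positivity
  calc ∑ t ∈ Finset.range T, ∑ g ∈ S, ψ.memFullRegret I g (σ t)
      = ∑ t ∈ Finset.range T, ∑ J : G.InfoSet j, ∑ g' ∈ memories Act J.path.length,
          (∑ g ∈ S, if I.BeforeEq J ∧ g <:+ g' then (1 : ℝ) else 0) *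
            (ψ.memProb J g' (σ t j) * cfRegret (σ t) J (ψ J g').1) := by
        refine Finset.sum_congr rfl fun t _ => ?_
        rw [Finset.sum_congr rfl fun g hg =>
          memFullRegret_eq_sum hr ψ I g (mem_memories.1 (hS hg)) (σ t), Finset.sum_comm]
        refine Finset.sum_congr rfl fun J _ => ?_
        rw [Finset.sum_comm]
        exact Finset.sum_congr rfl fun g' _ => by rw [Finset.sum_mul]
    _ = ∑ J : G.InfoSet j, ∑ g' ∈ memories Act J.path.length,
          (∑ g ∈ S, if I.BeforeEq J ∧ g <:+ g' then (1 : ℝ) else 0) *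
            ∑ t ∈ Finset.range T, ψ.memProb J g' (σ t j) * cfRegret (σ t) J (ψ J g').1 := by
        rw [Finset.sum_comm]
        refine Finset.sum_congr rfl fun J _ => ?_
        rw [Finset.sum_comm]
        exact Finset.sum_congr rfl fun g' _ => by rw [Finset.mul_sum]
    _ ≤ ∑ J : G.InfoSet j, ∑ g' ∈ memories Act J.path.length,
          if g' ∈ ψ.realizable J ∧ (ψ J g').1 ≠ id then B else 0 := by
        refine Finset.sum_le_sum fun J _ => Finset.sum_le_sum fun g' _ => ?_
        have h0 : 0 ≤ ∑ g ∈ S, if I.BeforeEq J ∧ g <:+ g' then (1 : ℝ) else 0 :=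
          Finset.sum_nonneg fun g _ => by split_ifs <;> simp
        refine (mul_le_mul_of_nonneg_left
          (hψ.sum_weighted_cfRegret_le hr hU hσ J g' T) h0).trans ?_
        refine mul_le_of_le_one_left ?_ (sum_suffix_indicator_le_one S _ hS _ g')
        split_ifs
        · exact hB0
        · exact le_rfl
    _ ≤ ∑ J : G.InfoSet j, 2 ^ nIN Φ * B := by
        refine Finset.sum_le_sum fun J _ => ?_
        rw [← Finset.sum_filter, Finset.sum_const, nsmul_eq_mul]
        exact mul_le_mul_of_nonneg_right (hψ.card_active_le J) hB0
    _ = _ := by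
        rw [Finset.sum_const, nsmul_eq_mul, Finset.card_univ, Fintype.card_coe, hB, pow_succ]
        ring

theorem BehDev.CoveredBy.memFullRegret_le (hr : G.PerfectRecall j) {U : ℝ}
    (hU : ∀ z ∈ G.terminals, |G.utility j z| ≤ U) {Φ : Set (G.BehDev j)} {σ : ℕ → G.Profile}
    (hσ : FollowsEFR Φ σ) {ψ : G.BehDev j} (hψ : ψ.CoveredBy Φ) (I : G.InfoSet j)
    (g : Memory Act) (T : ℕ) :
    ∑ t ∈ Finset.range T, ψ.memFullRegret I g (σ t) ≤
      2 ^ (nIN Φ + 1) * U * ((G.infosets j).card : ℝ) *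
        Real.sqrt ((bigD Φ : ℝ) * (T : ℝ)) := by
  by_cases hg : g.length = I.path.length
  · simpa using hψ.sum_memFullRegret_le hr hU hσ I {g}
      (Finset.singleton_subset_iff.2 (mem_memories.2 hg)) T
  · have hU0 := nonneg_of_utility_bound hU
    simp only [memFullRegret_eq_zero_of_length_ne ψ I g hg, Finset.sum_const_zero]
    positivity

theorem BehDev.CoveredBy.fullRegret_le (hr : G.PerfectRecall j) {U : ℝ}
    (hU : ∀ z ∈ G.terminals, |G.utility j z| ≤ U) {Φ : Set (G.BehDev j)} {σ : ℕ → G.Profile}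
    (hσ : FollowsEFR Φ σ) {ψ : G.BehDev j} (hψ : ψ.CoveredBy Φ) (I : G.InfoSet j) (T : ℕ) :
    ∑ t ∈ Finset.range T, fullRegret ψ.toSwap I (σ t) ≤
      2 ^ (nIN Φ + 1) * U * ((G.infosets j).card : ℝ) *
        Real.sqrt ((bigD Φ : ℝ) * (T : ℝ)) := by
  simp only [fullRegret_toSwap hr]
  exact hψ.sum_memFullRegret_le hr hU hσ I _ subset_rfl T

theorem exists_coveredBy_of_mem (hr : G.PerfectRecall j) {Φ : Set (G.BehDev j)}
    {ψ : G.Pure j → G.Pure j}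
    (hψ : ψ ∈ BehDev.toSwap '' Φ ∪ singleTarget (BehDev.toSwap '' Φ)) :
    ∃ φ : G.BehDev j, φ.CoveredBy Φ ∧ φ.toSwap = ψ := by
  rcases hψ with ⟨φ, hφ, rfl⟩ | ⟨_, ⟨φ, hφ, rfl⟩, J, rfl⟩
  · exact ⟨φ, BehDev.coveredBy_of_mem hφ, rfl⟩
  · exact ⟨φ.upTo J, BehDev.coveredBy_upTo hr hφ J, BehDev.toSwap_upTo hr φ J⟩

/-- Cumulative regret of order `√T` makes the average regret vanish. -/
theorem eventually_average_le {S : ℕ → ℝ} {C D : ℝ}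
    (hS : ∀ T : ℕ, S T ≤ C * Real.sqrt (D * (T : ℝ))) (hD : 0 ≤ D) {ε : ℝ} (hε : 0 < ε) :
    ∀ᶠ T : ℕ in Filter.atTop, (1 / (T : ℝ)) * S T ≤ ε := by
  have hlim : Filter.Tendsto (fun T : ℕ => C * Real.sqrt (D / (T : ℝ))) Filter.atTop
      (nhds 0) := by
    have h := ((tendsto_const_div_atTop_nhds_zero_nat D).sqrt).const_mul C
    simpa using h
  filter_upwards [hlim.eventually_le_const hε, Filter.eventually_gt_atTop 0] with T hT hpos
  have hpos' : (0 : ℝ) < T := by exact_mod_cast hpos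
  refine le_trans ?_ hT
  calc (1 / (T : ℝ)) * S T ≤ (1 / (T : ℝ)) * (C * Real.sqrt (D * (T : ℝ))) := by
        gcongr
        exact hS T
    _ = C * Real.sqrt (D / (T : ℝ)) := by
        rw [Real.sqrt_mul hD, Real.sqrt_div hD]
        have hs : Real.sqrt (T : ℝ) * Real.sqrt (T : ℝ) = T := Real.mul_self_sqrt hpos'.le
        have hs0 : Real.sqrt (T : ℝ) ≠ 0 := (Real.sqrt_pos.2 hpos').ne'
        field_simp
        rw [sq, hs]
        ring

end EFG

end

theorem theorem2 {ι Act Info : Type*} [Fintype Act] (G : EFG ι Act Info) (i : ι)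
    (hrecall : G.PerfectRecall i)
    (U : ℝ) (hU : ∀ z ∈ G.terminals, |G.utility i z| ≤ U)
    (Φ : Set (G.BehDev i))
    (σ : ℕ → G.Profile) (hσ : EFG.FollowsEFR Φ σ) :
    (∀ T : ℕ, ∀ I : G.InfoSet i,
      (∀ ψ ∈ EFG.BehDev.toSwap '' Φ ∪ EFG.singleTarget (EFG.BehDev.toSwap '' Φ),
        ∑ t ∈ Finset.range T, EFG.fullRegret ψ I (σ t) ≤
          2 ^ (EFG.nIN Φ + 1) * U * ((G.infosets i).card : ℝ) *
            Real.sqrt ((EFG.bigD Φ : ℝ) * (T : ℝ))) ∧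
      (∀ φ ∈ Φ ∪ {φ' | ∃ φ ∈ Φ, ∃ J : G.InfoSet i, φ' = EFG.BehDev.upTo φ J},
        ∀ g : EFG.Memory Act,
        ∑ t ∈ Finset.range T, EFG.BehDev.memFullRegret φ I g (σ t) ≤
          2 ^ (EFG.nIN Φ + 1) * U * ((G.infosets i).card : ℝ) *
            Real.sqrt ((EFG.bigD Φ : ℝ) * (T : ℝ)))) ∧
    EFG.OSHindsightRational
      (EFG.BehDev.toSwap '' Φ ∪ EFG.singleTarget (EFG.BehDev.toSwap '' Φ)) σ := by
  refine ⟨fun T I => ⟨fun ψ hψ => ?_, ?_⟩, fun ψ hψ I ε hε => ?_⟩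
  · obtain ⟨φ, hφ, rfl⟩ := EFG.exists_coveredBy_of_mem hrecall hψ
    exact hφ.fullRegret_le hrecall hU hσ I T
  · rintro φ (hφ | ⟨φ, hφ, J, rfl⟩) g
    · exact (EFG.BehDev.coveredBy_of_mem hφ).memFullRegret_le hrecall hU hσ I g T
    · exact (EFG.BehDev.coveredBy_upTo hrecall hφ J).memFullRegret_le hrecall hU hσ I g T
  · obtain ⟨φ, hφ, rfl⟩ := EFG.exists_coveredBy_of_mem hrecall hψ
    exact EFG.eventually_average_le (fun T => hφ.fullRegret_le hrecall hU hσ I T)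
      (Nat.cast_nonneg _) hε
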